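/- Let $M$ be a smooth (finite-dimensional, Hausdorff, second countable) manifold and $\nabla$ a smooth torsion-free affine connection on $M$. Let $\mathfrak X^\bullet_{\rm sym}(M)=\bigoplus_{r\ge 0}\Gamma(\mathrm{Sym}^rTM)$ be the space of symmetric multivector fields, with the symmetric product $\odot$, given for $\mathcal X$ of degree $r$ and $\mathcal Y$ of degree $s$ by $$(\mathcal X\odot\mathcal Y)(\alpha_1,\dots,\alpha_{r+s})=\frac1{r!\,s!}\sum_{\sigma\in S_{r+s}}\mathcal X(\alpha_{\sigma(1)},\dots,\alpha_{\sigma(r)})\,\mathcal Y(\alpha_{\sigma(r+1)},\dots,\alpha_{\sigma(r+s)}).$$ Then there is a unique $\mathbb R$-bilinear map $[\,,]_s$ on $\mathfrak X^\bullet_{\rm sym}(M)$, the symmetric Schouten bracket, which is commutative, satisfies $[X,f]_s=Xf$ and $[X,Y]_s=\nabla_XY+\nabla_YX$ for vector fields $X,Y$ and smooth functions $f$, and is such that for $\mathcal X$ of degree $r$ the map $[\mathcal X,\cdot]_s$ is a derivation of $\odot$ of degree $r-1$ (in particular $[f,g]_s=0$ for functions). Let $\mathrm{pr}:T^*M\to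 M$ be the projection. The connection on $T^*M$ dual to $\nabla$ gives a splitting $T_\zeta(T^*M)\cong T_xM\oplus T^*_xM$ ($\zeta\in T_x^*M$) into horizontal and vertical parts. The Patterson–Walker metric $g_\nabla$ on $T^*M$ is the pairing $\langle X+\alpha,Y+\beta\rangle=\alpha(Y)+\beta(X)$ transported by this splitting, and $\{F,G\}_\nabla=g_\nabla^{-1}(\mathrm dF,\mathrm dG)$. Let $\mathcal Pol(T^*M)\subset C^\infty(T^*M)$ be the space of polynomials in momenta, i.e. the sum over $r\ge0$ of the spaces of smooth $F$ with $F(\lambda\zeta)=\lambda^rF(\zeta)$ for all $\lambda\in\mathbb R$, $\zeta\in T^*M$. The space $\mathcal Pol(T^*M)$ is closed under $\{\,,\}_\nabla$, so that $(\mathcal Pol(T^*M),\{\,,\}_\nabla)$ is a commutative (not necessarily associative) algebra. The vertical lift, i.e. the linear map given on degree-$r$ fields by $$\mathcal X^v(\zeta)=\frac1{r!}\,\mathcal X(\zeta,\dots,\zeta)$$ ($f^v=f\circ\mathrm{pr}$ for $r=0$), is an algebra isomorphism $$(\mathfrak X^\bullet_{\rm sym}(M),[\,,]_s)\;\xrightarrow{\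 \sim\ }\;(\mathcal Pol(T^*M),\{\,,\}_\nabla),$$ that is, a linear bijection onto $\mathcal Pol(T^*M)$ with $([\mathcal X,\mathcal Y]_s)^v=\{\mathcal X^v,\mathcal Y^v\}_\nabla$ for all $\mathcal X,\mathcal Y$. -/

import Mathlib

open Bundle FiberBundle
open scoped Manifold ContDiff DirectSum

noncomputable section

namespace SymPoisson

variable (E : Type*) [NormedAddCommGroup E] [NormedSpace ℝ E]
  (M : Type*) [TopologicalSpace M] [ChartedSpace E M]

/-! ### The cotangent bundle -/

variable {M} in
/-- The cotangent space `T*_x M`, the dual of the tangent space. -/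
abbrev CotangentSpace (x : M) : Type _ := TangentSpace 𝓘(ℝ, E) x →L[ℝ] ℝ

/-- The total space of the cotangent bundle `T*M`. -/
abbrev CotangentBundle : Type _ := TotalSpace (E →L[ℝ] ℝ) (fun x : M => CotangentSpace E x)

/-- The model with corners of the total space of the cotangent bundle. -/
abbrev cotangentModel : ModelWithCorners ℝ (E × (E →L[ℝ] ℝ)) (ModelProd E (E →L[ℝ] ℝ)) :=
  𝓘(ℝ, E).prod 𝓘(ℝ, E →L[ℝ] ℝ)

variable {E M} in
/-- The 1-form `α` on `M` is smooth at `x`. -/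
def SmoothOneFormAt (α : Π x : M, CotangentSpace E x) [IsManifold 𝓘(ℝ, E) ∞ M] (x : M) : Prop :=
  ContMDiffAt 𝓘(ℝ, E) (cotangentModel E) ∞ (fun y => (⟨y, α y⟩ : CotangentBundle E M)) x

variable [IsManifold 𝓘(ℝ, E) ∞ M]

/-- Smooth functions on `M`. -/
abbrev SmoothFun : Type _ := C^∞⟮𝓘(ℝ, E), M; 𝓘(ℝ, ℝ), ℝ⟯

/-- Smooth vector fields on `M`. -/
abbrev SmoothVectorField : Type _ := Cₛ^∞⟮𝓘(ℝ, E); E, (TangentSpace 𝓘(ℝ, E) : M → Type _)⟯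

/-- Smooth functions on `T*M`. -/
abbrev SmoothFunCotangent : Type _ :=
  C^∞⟮cotangentModel E, CotangentBundle E M; 𝓘(ℝ, ℝ), ℝ⟯

/-! ### Symmetric multivector fields -/

/-- The symmetric multivector fields of degree `r` on `M`, the smooth sections of `Sym^r TM`: at
each point `x` a symmetric `r`-linear form on `T*_x M`, such that the evaluation on 1-forms is a
smooth function wherever the 1-forms are smooth. -/
def SymMultivectorField (r : ℕ) :
    Submodule ℝ (Π x : M, MultilinearMap ℝ (fun _ : Fin r => CotangentSpace E x) ℝ) where
  carrier := {X | (∀ (x : M) (σ : Equiv.Perm (Fin r)) (v : Fin r → CotangentSpace E x),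
      X x (v ∘ σ) = X x v) ∧
    ∀ (x : M) (α : Fin r → Π y : M, CotangentSpace E y), (∀ i, SmoothOneFormAt (α i) x) →
      ContMDiffAt 𝓘(ℝ, E) 𝓘(ℝ, ℝ) ∞ (fun y => X y (fun i => α i y)) x}
  add_mem' := by
    rintro X Y ⟨hX, hX'⟩ ⟨hY, hY'⟩
    refine ⟨fun x σ v => by simp [hX, hY], fun x α hα => ?_⟩
    exact (hX' x α hα).add (hY' x α hα)
  zero_mem' := ⟨fun x σ v => rfl, fun x α hα => contMDiffAt_const⟩
  smul_mem' := by
    rintro c X ⟨hX, hX'⟩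
    refine ⟨fun x σ v => by simp [hX], fun x α hα => ?_⟩
    exact contMDiffAt_const.mul (hX' x α hα)

/-- The space of all symmetric multivector fields, the direct sum over all degrees. -/
abbrev SymMultivectorFields : Type _ := ⨁ r : ℕ, SymMultivectorField E M r

section product

variable {V : Type*} [AddCommGroup V] [Module ℝ V] {r s : ℕ}

/-- The tensor product `a ⊗ b` of two multilinear forms. -/
def tensorForm (a : MultilinearMap ℝ (fun _ : Fin r => V) ℝ)
    (b : MultilinearMap ℝ (fun _ : Fin s => V) ℝ) :
    MultilinearMap ℝ (fun _ : Fin (r + s) => V) ℝ :=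
  ((LinearMap.mul' ℝ ℝ).compMultilinearMap (a.domCoprod b)).domDomCongr finSumFinEquiv

theorem tensorForm_apply (a : MultilinearMap ℝ (fun _ : Fin r => V) ℝ)
    (b : MultilinearMap ℝ (fun _ : Fin s => V) ℝ) (v : Fin (r + s) → V) :
    tensorForm a b v = a (fun i => v (Fin.castAdd s i)) * b (fun j => v (Fin.natAdd r j)) := by
  simp [tensorForm]

/-- The symmetric product of two multilinear forms,
`(a ⊙ b)(v) = 1/(r! s!) ∑_σ a(v_σ(1), …, v_σ(r)) b(v_σ(r+1), …, v_σ(r+s))`.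
For vectors this reads `X ⊙ Y = X ⊗ Y + Y ⊗ X`. -/
def symProdForm (a : MultilinearMap ℝ (fun _ : Fin r => V) ℝ)
    (b : MultilinearMap ℝ (fun _ : Fin s => V) ℝ) :
    MultilinearMap ℝ (fun _ : Fin (r + s) => V) ℝ :=
  ((r.factorial : ℝ) * (s.factorial : ℝ))⁻¹ •
    ∑ σ : Equiv.Perm (Fin (r + s)), (tensorForm a b).domDomCongr σ

theorem symProdForm_apply (a : MultilinearMap ℝ (fun _ : Fin r => V) ℝ)
    (b : MultilinearMap ℝ (fun _ : Fin s => V) ℝ) (v : Fin (r + s) → V) :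
    symProdForm a b v = ((r.factorial : ℝ) * (s.factorial : ℝ))⁻¹ *
      ∑ σ : Equiv.Perm (Fin (r + s)),
        a (fun i => v (σ (Fin.castAdd s i))) * b (fun j => v (σ (Fin.natAdd r j))) := by
  simp [symProdForm, tensorForm_apply]

end product

/-- The symmetric product of homogeneous symmetric multivector fields, as a bilinear map. -/
def symProdHom (r s : ℕ) : SymMultivectorField E M r →ₗ[ℝ] SymMultivectorField E M s →ₗ[ℝ]
    SymMultivectorField E M (r + s) :=
  LinearMap.mk₂ ℝ
    (fun X Y => ⟨fun x => symProdForm (X.1 x) (Y.1 x), by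
      refine ⟨fun x σ v => ?_, fun x α hα => ?_⟩
      · simp only [symProdForm_apply, Function.comp]
        congr 1
        exact Fintype.sum_equiv (Equiv.mulLeft σ) _ _ (fun τ => by simp [Equiv.Perm.mul_apply])
      · simp only [symProdForm_apply]
        refine contMDiffAt_const.mul (ContMDiffAt.sum fun σ _ => ?_)
        exact (X.2.2 x _ fun i => hα _).mul (Y.2.2 x _ fun i => hα _)⟩)
    (fun X X' Y => by
      ext x v; simp [symProdForm_apply, add_mul, mul_add, Finset.sum_add_distrib])
    (fun c X Y => by
      ext x v; simp [symProdForm_apply, Finset.mul_sum]; congr! 1; ring)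
    (fun X Y Y' => by
      ext x v; simp [symProdForm_apply, mul_add, Finset.sum_add_distrib])
    (fun c X Y => by
      ext x v; simp [symProdForm_apply, Finset.mul_sum]; congr! 1; ring)

/-- The symmetric product `⊙` of symmetric multivector fields. -/
def symProd : SymMultivectorFields E M →ₗ[ℝ] SymMultivectorFields E M →ₗ[ℝ]
    SymMultivectorFields E M :=
  DirectSum.toModule ℝ ℕ _ fun r => LinearMap.flip <| DirectSum.toModule ℝ ℕ _ fun s =>
    LinearMap.flip <| (symProdHom E M r s).compr₂
      (DirectSum.lof ℝ ℕ (fun k => SymMultivectorField E M k) (r + s))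

variable {E M}

/-- The inclusion of degree-`r` symmetric multivector fields into all of them. -/
abbrev incl (r : ℕ) (X : SymMultivectorField E M r) : SymMultivectorFields E M :=
  DirectSum.lof ℝ ℕ (fun k => SymMultivectorField E M k) r X

theorem symProd_incl (r s : ℕ) (X : SymMultivectorField E M r) (Y : SymMultivectorField E M s) :
    symProd E M (incl r X) (incl s Y) = incl (r + s) (symProdHom E M r s X Y) := by
  simp [symProd, incl]

/-- A smooth function, as a symmetric multivector field of degree `0`. -/
def ofFun (f : SmoothFun E M) : SymMultivectorField E M 0 :=
  ⟨fun x => MultilinearMap.constOfIsEmpty ℝ _ (f x), fun _ _ _ => rfl, fun x _ _ => f.contMDiff x⟩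

/-- A smooth vector field, as a symmetric multivector field of degree `1`. -/
def ofVec (X : SmoothVectorField E M) : SymMultivectorField E M 1 :=
  ⟨fun x => MultilinearMap.ofSubsingleton ℝ (CotangentSpace E x) ℝ 0
      { toFun := fun α => α (X x), map_add' := fun _ _ => rfl, map_smul' := fun _ _ => rfl }, by
    refine ⟨fun x σ v => by simp [Subsingleton.elim σ 1], fun x α hα => ?_⟩
    have h := ContMDiffAt.clm_bundle_apply (E₂ := Bundle.Trivial M ℝ) (F₂ := ℝ) (hα 0)
      (X.contMDiff x)
    rw [contMDiffAt_totalSpace] at h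
    exact h.2⟩

theorem ofVec_apply (X : SmoothVectorField E M) (x : M) (v : Fin 1 → CotangentSpace E x) :
    (ofVec X).1 x v = v 0 (X x) := rfl

/-- The derivative `X f` of the function `f` along the vector field `X`. -/
def lieDeriv (X : SmoothVectorField E M) (f : SmoothFun E M) : SmoothFun E M :=
  ⟨fun x => mvfderiv 𝓘(ℝ, E) f x (X x), by
    have h1 : ContMDiff 𝓘(ℝ, E).tangent 𝓘(ℝ, ℝ).tangent ∞ (tangentMap 𝓘(ℝ, E) 𝓘(ℝ, ℝ) f) :=
      f.contMDiff.contMDiff_tangentMap le_rfl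
    exact ((contMDiff_snd_tangentBundle_modelSpace ℝ 𝓘(ℝ, ℝ)).comp h1).comp X.contMDiff⟩

variable [FiniteDimensional ℝ E]
  (nabla : CovariantDerivative 𝓘(ℝ, E) E (TangentSpace 𝓘(ℝ, E) : M → Type _))

/-- The symmetric bracket `[X, Y]_s = ∇_X Y + ∇_Y X` of vector fields. -/
def symBracket [CovariantDerivative.ContMDiffCovariantDerivative nabla ∞] (X Y : SmoothVectorField E M) :
    SmoothVectorField E M :=
  ⟨fun x => nabla Y x (X x) + nabla X x (Y x), by
    have key : ∀ X Y : SmoothVectorField E M, ContMDiff 𝓘(ℝ, E) 𝓘(ℝ, E).tangent ∞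
        (fun x => (⟨x, nabla Y x (X x)⟩ : TangentBundle 𝓘(ℝ, E) M)) := by
      intro X Y
      have h := (CovariantDerivative.ContMDiffCovariantDerivative.contMDiff
        (cov := nabla) (k := ∞)).contMDiff Y.contMDiff.contMDiffOn
      rw [contMDiffOn_univ] at h
      exact h.clm_bundle_apply X.contMDiff
    exact (key X Y).add_section (key Y X)⟩

/-- The defining properties of the symmetric Schouten bracket of the connection `nabla`. -/
structure IsSymSchoutenBracket [CovariantDerivative.ContMDiffCovariantDerivative nabla ∞]
    (B : SymMultivectorFields E M →ₗ[ℝ] SymMultivectorFields E M →ₗ[ℝ]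
      SymMultivectorFields E M) : Prop where
  /-- `[X, f]_s = X f`. -/
  vec_fun : ∀ (X : SmoothVectorField E M) (f : SmoothFun E M),
    B (incl 1 (ofVec X)) (incl 0 (ofFun f)) = incl 0 (ofFun (lieDeriv X f))
  /-- On vector fields it is the symmetric bracket. -/
  vec_vec : ∀ X Y : SmoothVectorField E M,
    B (incl 1 (ofVec X)) (incl 1 (ofVec Y)) = incl 1 (ofVec (symBracket nabla X Y))
  /-- `[X, ]_s` has degree `r - 1` if `X` has degree `r`; the bracket vanishes if `r + s = 0`. -/
  degree : ∀ (r s : ℕ) (X : SymMultivectorField E M r) (Y : SymMultivectorField E M s) (k : ℕ),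
    k + 1 ≠ r + s → B (incl r X) (incl s Y) k = 0
  /-- `[X, ]_s` is a derivation of the symmetric product. -/
  derivation : ∀ X Y Z : SymMultivectorFields E M,
    B X (symProd E M Y Z) = symProd E M (B X Y) Z + symProd E M Y (B X Z)
  /-- The bracket is commutative. -/
  comm : ∀ X Y : SymMultivectorFields E M, B X Y = B Y X

/-! ### Polynomials in momenta and the vertical lift -/

variable (E M) in
/-- The polynomials in momenta of degree `r`: the smooth functions `F` on `T*M` with
`F (c ζ) = c ^ r F ζ` for all real `c`. -/
def PolDeg (r : ℕ) : Submodule ℝ (SmoothFunCotangent E M) where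
  carrier := {F | ∀ (c : ℝ) (x : M) (ζ : CotangentSpace E x), F ⟨x, c • ζ⟩ = c ^ r * F ⟨x, ζ⟩}
  add_mem' := by
    intro F G hF hG c x ζ
    simp only [ContMDiffMap.coe_add, Pi.add_apply, hF c x ζ, hG c x ζ]
    ring
  zero_mem' := by intro c x ζ; simp
  smul_mem' := by
    intro a F hF c x ζ
    simp only [ContMDiffMap.coe_smul, Pi.smul_apply, hF c x ζ, smul_eq_mul]
    ring

variable (E M) in
/-- The polynomials in momenta, the sum of the spaces of polynomials of degree `r`. -/
def Pol : Submodule ℝ (SmoothFunCotangent E M) := ⨆ r : ℕ, PolDeg E M r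

/-- The vertical lift of a symmetric multivector field, `ζ ↦ ∑_r 1/r! X_r(ζ, …, ζ)`. -/
def verticalLift (X : SymMultivectorFields E M) (ζ : CotangentBundle E M) : ℝ :=
  DirectSum.toModule ℝ ℕ ℝ
    (fun r =>
      { toFun := fun Y : SymMultivectorField E M r =>
          (r.factorial : ℝ)⁻¹ * Y.1 ζ.proj (fun _ => ζ.snd)
        map_add' := fun Y Z => by simp [mul_add]
        map_smul' := fun c Y => by simp; ring }) X

theorem verticalLift_incl (r : ℕ) (X : SymMultivectorField E M r) (ζ : CotangentBundle E M) :
    verticalLift (incl r X) ζ = (r.factorial : ℝ)⁻¹ * X.1 ζ.proj (fun _ => ζ.snd) := by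
  simp [verticalLift, incl]

/-! ### The Patterson–Walker metric and bracket -/

/-- The differential of the projection `T*M → M`. -/
def projDeriv (ζ : CotangentBundle E M) :
    TangentSpace (cotangentModel E) ζ →L[ℝ] TangentSpace 𝓘(ℝ, E) ζ.proj :=
  mfderiv (cotangentModel E) 𝓘(ℝ, E) (fun η : CotangentBundle E M => η.proj) ζ

/-- The fibrewise linear function `ζ ↦ ζ(Y)` on `T*M` of a vector field `Y` on `M`. -/
def momentum (Y : Π x : M, TangentSpace 𝓘(ℝ, E) x) (ζ : CotangentBundle E M) : ℝ :=
  ζ.snd (Y ζ.proj)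

theorem mdifferentiableAt_momentum {Y : Π x : M, TangentSpace 𝓘(ℝ, E) x}
    {ζ : CotangentBundle E M}
    (hY : MDifferentiableAt 𝓘(ℝ, E) 𝓘(ℝ, E).tangent (fun x => (⟨x, Y x⟩ : TangentBundle 𝓘(ℝ, E) M))
      ζ.proj) :
    MDifferentiableAt (cotangentModel E) 𝓘(ℝ, ℝ) (momentum Y) ζ := by
  have h1 : MDifferentiableAt (cotangentModel E) 𝓘(ℝ, E).tangent
      (fun η : CotangentBundle E M => (⟨η.proj, Y η.proj⟩ : TangentBundle 𝓘(ℝ, E) M)) ζ :=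
    hY.comp ζ (mdifferentiableAt_proj (fun x : M => CotangentSpace E x))
  have h2 : MDifferentiableAt (cotangentModel E) (cotangentModel E)
      (fun η : CotangentBundle E M => (⟨η.proj, η.snd⟩ : CotangentBundle E M)) ζ :=
    mdifferentiableAt_id
  have h := MDifferentiableAt.clm_bundle_apply (E₂ := Bundle.Trivial M ℝ) (F₂ := ℝ) h2 h1
  rw [mdifferentiableAt_totalSpace] at h
  exact h.2

theorem tensorialAt_connector (ζ : CotangentBundle E M) (u : TangentSpace (cotangentModel E) ζ) :
    TensorialAt 𝓘(ℝ, E) E (fun Y : Π x : M, TangentSpace 𝓘(ℝ, E) x =>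
      mvfderiv (cotangentModel E) (momentum Y) ζ u -
        ζ.snd (nabla Y ζ.proj (projDeriv ζ u))) ζ.proj where
  smul := by
    intro f Y hf hY
    have hp : MDifferentiableAt (cotangentModel E) 𝓘(ℝ, E)
        (fun η : CotangentBundle E M => η.proj) ζ :=
      mdifferentiableAt_proj (fun x : M => CotangentSpace E x)
    have hfp : MDifferentiableAt (cotangentModel E) 𝓘(ℝ, ℝ)
        (f ∘ fun η : CotangentBundle E M => η.proj) ζ := hf.comp ζ hp
    have e : momentum (E := E) (M := M) (f • Y) =
        (f ∘ fun η : CotangentBundle E M => η.proj) * momentum Y := by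
      ext η; simp [momentum]
    rw [e, mvfderiv_mul hfp (mdifferentiableAt_momentum hY),
      nabla.isCovariantDerivativeOnUniv.leibniz hY hf]
    have := mvfderiv_comp_apply ζ hf hp u
    simp [this, momentum, projDeriv]
    ring
  add := by
    intro Y Z hY hZ
    have e : momentum (E := E) (M := M) (Y + Z) = momentum Y + momentum Z := by
      ext η; simp [momentum]
    rw [e, mvfderiv_add (mdifferentiableAt_momentum hY) (mdifferentiableAt_momentum hZ),
      nabla.isCovariantDerivativeOnUniv.add hY hZ]
    simp
    ring

/-- The vertical part `K u ∈ T*_x M` of a tangent vector `u` of `T*M` at `ζ ∈ T*_x M`, for the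
connection on `T*M` dual to `nabla`: the covector with
`(K u)(Y) = u(ζ ↦ ζ(Y)) - ζ(∇_{pr_* u} Y)` for all vector fields `Y` on `M`.
The horizontal vectors are those with `K u = 0`; on the tangent vector `u = α_* v` of a 1-form `α`
one has `K u = ∇_v α`. -/
def connector (ζ : CotangentBundle E M) (u : TangentSpace (cotangentModel E) ζ) :
    CotangentSpace E ζ.proj :=
  TensorialAt.mkHom _ ζ.proj (tensorialAt_connector nabla ζ u)

theorem connector_apply (ζ : CotangentBundle E M) (u : TangentSpace (cotangentModel E) ζ)
    {Y : Π x : M, TangentSpace 𝓘(ℝ, E) x}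
    (hY : MDifferentiableAt 𝓘(ℝ, E) 𝓘(ℝ, E).tangent
      (fun x => (⟨x, Y x⟩ : TangentBundle 𝓘(ℝ, E) M)) ζ.proj) :
    connector nabla ζ u (Y ζ.proj) = mvfderiv (cotangentModel E) (momentum Y) ζ u -
      ζ.snd (nabla Y ζ.proj (projDeriv ζ u)) :=
  TensorialAt.mkHom_apply (tensorialAt_connector nabla ζ u) hY

/-- The projection of tangent vectors of `T*M` to their horizontal and vertical parts. -/
def splittingMap (ζ : CotangentBundle E M) : TangentSpace (cotangentModel E) ζ →ₗ[ℝ]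
    TangentSpace 𝓘(ℝ, E) ζ.proj × CotangentSpace E ζ.proj where
  toFun u := (projDeriv ζ u, connector nabla ζ u)
  map_add' u w := by
    refine Prod.ext ((projDeriv ζ).map_add u w) ?_
    ext y
    change connector nabla ζ (u + w) y = connector nabla ζ u y + connector nabla ζ w y
    simp only [connector, TensorialAt.mkHom_apply_eq_extend, ContinuousLinearMap.map_add]
    ring
  map_smul' c u := by
    refine Prod.ext ((projDeriv ζ).map_smul c u) ?_
    ext y
    change connector nabla ζ (c • u) y = c * connector nabla ζ u y
    simp only [connector, TensorialAt.mkHom_apply_eq_extend, ContinuousLinearMap.map_smul,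
      smul_eq_mul]
    ring

theorem mfderiv_extChartAt_apply {G : Type*} [NormedAddCommGroup G] [NormedSpace ℝ G]
    (ζ : CotangentBundle E M) (u : TangentSpace (cotangentModel E) ζ)
    (L : (E × (E →L[ℝ] ℝ)) →L[ℝ] G) {f : CotangentBundle E M → G}
    (hf : f =ᶠ[nhds ζ] (fun η => L (extChartAt (cotangentModel E) ζ η))) :
    L (mfderiv (cotangentModel E) 𝓘(ℝ, E × (E →L[ℝ] ℝ)) (extChartAt (cotangentModel E) ζ) ζ u) =
      mfderiv (cotangentModel E) 𝓘(ℝ, G) f ζ u := by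
  have hφ : MDifferentiableAt (cotangentModel E) 𝓘(ℝ, E × (E →L[ℝ] ℝ))
      (extChartAt (cotangentModel E) ζ) ζ := mdifferentiableAt_extChartAt (mem_chart_source _ ζ)
  rw [hf.mfderiv_eq]
  have h := mfderiv_comp_apply ζ (I' := 𝓘(ℝ, E × (E →L[ℝ] ℝ))) (I'' := 𝓘(ℝ, G)) (g := L)
    L.mdifferentiableAt hφ u
  rw [L.mfderiv_eq] at h
  exact h.symm

theorem splittingMap_injective (ζ : CotangentBundle E M) :
    Function.Injective (splittingMap nabla ζ) := by
  rw [← LinearMap.ker_eq_bot, LinearMap.ker_eq_bot']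
  intro u hu
  have h1 : projDeriv ζ u = 0 := congrArg Prod.fst hu
  have h2 : connector nabla ζ u = 0 := congrArg Prod.snd hu
  have h3 : ∀ Y : Π x : M, TangentSpace 𝓘(ℝ, E) x, MDifferentiableAt 𝓘(ℝ, E) 𝓘(ℝ, E).tangent
      (fun x => (⟨x, Y x⟩ : TangentBundle 𝓘(ℝ, E) M)) ζ.proj →
      mvfderiv (cotangentModel E) (momentum Y) ζ u = 0 := by
    intro Y hY
    have := connector_apply nabla ζ u hY
    rw [h1, h2, zero_apply, ContinuousLinearMap.map_zero,
      ContinuousLinearMap.map_zero, sub_zero] at this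
    exact this.symm
  have hp : MDifferentiableAt (cotangentModel E) 𝓘(ℝ, E)
      (fun η : CotangentBundle E M => η.proj) ζ :=
    mdifferentiableAt_proj (fun x : M => CotangentSpace E x)
  have inv := isInvertible_mfderiv_extChartAt (I := cotangentModel E)
    (mem_extChartAt_source (I := cotangentModel E) ζ)
  obtain ⟨e, he⟩ := inv
  have key : mfderiv (cotangentModel E) 𝓘(ℝ, E × (E →L[ℝ] ℝ))
      (extChartAt (cotangentModel E) ζ) ζ u = 0 := by
    have hs : (trivializationAt (E →L[ℝ] ℝ) (fun x : M => CotangentSpace E x) ζ.proj).source ∈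
        nhds ζ := (OpenPartialHomeomorph.open_source _).mem_nhds
          FiberBundle.mem_trivializationAt_proj_source
    refine Prod.ext ?_ ?_
    · have hf : (extChartAt 𝓘(ℝ, E) ζ.proj ∘ fun η : CotangentBundle E M => η.proj) =ᶠ[nhds ζ]
          (fun η => ContinuousLinearMap.fst ℝ E (E →L[ℝ] ℝ)
            (extChartAt (cotangentModel E) ζ η)) := by
        filter_upwards [hs] with η hη
        rw [FiberBundle.extChartAt]
        rfl
      refine (mfderiv_extChartAt_apply ζ u _ hf).trans ?_
      rw [mfderiv_comp_apply ζ (mdifferentiableAt_extChartAt (mem_chart_source _ _)) hp u]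
      exact (congrArg (mfderiv 𝓘(ℝ, E) 𝓘(ℝ, E) (extChartAt 𝓘(ℝ, E) ζ.proj) ζ.proj) h1).trans
        (mfderiv 𝓘(ℝ, E) 𝓘(ℝ, E) (extChartAt 𝓘(ℝ, E) ζ.proj) ζ.proj).map_zero
    · ext w
      let t := trivializationAt E (TangentSpace 𝓘(ℝ, E) : M → Type _) ζ.proj
      have ht : ζ.proj ∈ t.baseSet := FiberBundle.mem_baseSet_trivializationAt' _
      have hf : momentum (E := E) (M := M) (extend E (t.symm ζ.proj w))
          =ᶠ[nhds ζ]
          (fun η => ((ContinuousLinearMap.apply ℝ ℝ w).comp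
            (ContinuousLinearMap.snd ℝ E (E →L[ℝ] ℝ)))
            (extChartAt (cotangentModel E) ζ η)) := by
        filter_upwards [hs] with η hη
        rw [FiberBundle.extChartAt]
        have h1 : (t ⟨ζ.proj, t.symm ζ.proj w⟩).2 = w := by simp [ht]
        simp only [momentum, extend]
        erw [h1]
        have hb : η.proj ∈ t.baseSet := by
          rw [hom_trivializationAt_source] at hη
          exact hη.1
        have h2 := hom_trivializationAt_apply (σ := RingHom.id ℝ) (F₁ := E) (F₂ := ℝ)
          (E₁ := (TangentSpace 𝓘(ℝ, E) : M → Type _)) (E₂ := Bundle.Trivial M ℝ) ζ.proj η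
        have h3 := congrArg (fun p : M × (E →L[ℝ] ℝ) => p.2 w) h2
        refine Eq.trans ?_ h3.symm
        simp only [ContinuousLinearMap.inCoordinates, ContinuousLinearMap.comp_apply]
        rw [Bundle.Trivialization.symmL_apply _ hb]
        simp [t]
      refine (mfderiv_extChartAt_apply ζ u _ hf).trans ?_
      exact h3 _ (mdifferentiableAt_extend ..)
  rw [← he] at key
  exact e.injective (key.trans e.map_zero.symm)

theorem splittingMap_bijective (ζ : CotangentBundle E M) :
    Function.Bijective (splittingMap nabla ζ) := by
  have i1 : FiniteDimensional ℝ (TangentSpace 𝓘(ℝ, E) ζ.proj) := inferInstanceAs (FiniteDimensional ℝ E)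
  have i2 : FiniteDimensional ℝ (TangentSpace (cotangentModel E) ζ) :=
    inferInstanceAs (FiniteDimensional ℝ (E × (E →L[ℝ] ℝ)))
  have i3 : FiniteDimensional ℝ (CotangentSpace E ζ.proj) := inferInstanceAs (FiniteDimensional ℝ (E →L[ℝ] ℝ))
  refine ⟨splittingMap_injective nabla ζ, ?_⟩
  refine (LinearMap.injective_iff_surjective_of_finrank_eq_finrank ?_).1 (splittingMap_injective nabla ζ)
  rfl

/-- The decomposition `T_ζ(T*M) ≅ T_x M ⊕ T*_x M` into horizontal and vertical part, `ζ ∈ T*_x M`,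
given by the connection. -/
def splitting (ζ : CotangentBundle E M) : TangentSpace (cotangentModel E) ζ ≃ₗ[ℝ]
    TangentSpace 𝓘(ℝ, E) ζ.proj × CotangentSpace E ζ.proj :=
  LinearEquiv.ofBijective (splittingMap nabla ζ) (splittingMap_bijective nabla ζ)

/-- The canonical symmetric pairing `⟨X + α, Y + β⟩ = α(Y) + β(X)` on `T_x M ⊕ T*_x M`. -/
def symPairing (x : M) : LinearMap.BilinForm ℝ (TangentSpace 𝓘(ℝ, E) x × CotangentSpace E x) :=
  LinearMap.mk₂ ℝ (fun a b => a.2 b.1 + b.2 a.1)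
    (fun a a' b => by simp; ring) (fun c a b => by simp; ring)
    (fun a b b' => by simp; ring) (fun c a b => by simp; ring)

/-- The Patterson–Walker metric on `T*M`: the symmetric pairing transported by the decomposition
into horizontal and vertical vectors. -/
def pwMetric (ζ : CotangentBundle E M) :
    LinearMap.BilinForm ℝ (TangentSpace (cotangentModel E) ζ) :=
  (symPairing ζ.proj).compl₁₂ (splitting nabla ζ).toLinearMap (splitting nabla ζ).toLinearMap

theorem pwMetric_nondegenerate (ζ : CotangentBundle E M) : (pwMetric nabla ζ).Nondegenerate := by
  have h : ∀ u, (∀ w, pwMetric nabla ζ u w = 0) → u = 0 := by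
    intro u hu
    have h' : ∀ b, symPairing ζ.proj (splitting nabla ζ u) b = 0 := by
      intro b
      have := hu ((splitting nabla ζ).symm b)
      simpa [pwMetric] using this
    have h1 : splitting nabla ζ u = 0 := by
      refine Prod.ext ?_ ?_
      · refine (SeparatingDual.eq_zero_iff_forall_dual_eq_zero (R := ℝ) (V := E) _).2 fun β => ?_
        have h2 := h' (0, β)
        simp only [symPairing, LinearMap.mk₂_apply, map_zero, zero_add] at h2
        exact h2
      · ext y
        simpa [symPairing] using h' (y, 0)
    simpa using h1
  have symm : ∀ u w, pwMetric nabla ζ u w = pwMetric nabla ζ w u := by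
    intro u w
    simp [pwMetric, symPairing, add_comm]
  exact ⟨h, fun w hw => h w fun u => by rw [symm]; exact hw u⟩

instance finiteDimensional_tangentSpace (ζ : CotangentBundle E M) :
    FiniteDimensional ℝ (TangentSpace (cotangentModel E) ζ) :=
  inferInstanceAs (FiniteDimensional ℝ (E × (E →L[ℝ] ℝ)))

/-- The gradient of `F` for the Patterson–Walker metric: `g(grad F, w) = dF(w)`. -/
def pwGrad (F : CotangentBundle E M → ℝ) (ζ : CotangentBundle E M) :
    TangentSpace (cotangentModel E) ζ :=
  ((pwMetric nabla ζ).toDual (pwMetric_nondegenerate nabla ζ)).symm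
    (mvfderiv (cotangentModel E) F ζ).toLinearMap

/-- The Patterson–Walker bracket `{F, G} = g⁻¹(dF, dG) = dG(grad F)` of functions on `T*M`. -/
def pwBracket (F G : CotangentBundle E M → ℝ) (ζ : CotangentBundle E M) : ℝ :=
  mvfderiv (cotangentModel E) G ζ (pwGrad nabla F ζ)

end SymPoisson
end

open SymPoisson

/-! The vertical lift is a linear bijection onto the polynomials in momenta that turns `⊙` into the
pointwise product. The symmetric bracket can then be read off from the function bracket, once both
are compared on generators.

Bijectivity: on each fibre a smooth function homogeneous of degree `r` is determined by its `r`-th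
derivative at the origin (`exists_symmetric_diagonal_eq`). Polarization
(`factorial_mul_eq_sum_diagonal`) recovers a symmetric form from its diagonal. It gives injectivity
in each degree, and also the smoothness of the multivector field built fibre by fibre. Different
degrees are separated by scaling the covector (`liftAll_injective`).

Closure: the bracket of functions is symmetric and satisfies the Leibniz rule in each argument. Its
values on pull-backs `f ∘ pr` and momenta `ζ ↦ ζ(X)` are `0`, `X f` and the momentum of `∇_X Y + ∇_Y
X`; they follow from the splitting of the gradient (`pwGrad_eq`). Local frames write every
polynomial in momenta, near a point of `M`, as a sum of products of these generators
(`exists_isMomentumPoly`), so brackets of degrees `r` and `s` are polynomials of degree `r + s - 1`.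

Existence: the function bracket transported back along the lift satisfies all the axioms.
Uniqueness: the derivation property makes any symmetric Schouten bracket local (`liftAll_congr`), so
its arguments may be replaced by sums of products of generators, where the axioms fix its value. -/

noncomputable section

namespace SymPoisson

/-! ### Polarization and homogeneous smooth functions on a vector space. -/

section

/-- The polarization formula: a symmetric multilinear form is determined by its diagonal. -/
theorem factorial_mul_eq_sum_diagonal {V : Type*} [AddCommGroup V] [Module ℝ V] {r : ℕ}
    (m : MultilinearMap ℝ (fun _ : Fin r => V) ℝ)
    (hm : ∀ (σ : Equiv.Perm (Fin r)) (v : Fin r → V), m (v ∘ σ) = m v) (v : Fin r → V) :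
    (r.factorial : ℝ) * m v =
      ∑ s : Finset (Fin r), (-1 : ℝ) ^ (sᶜ).card * m (fun _ => ∑ i ∈ s, v i) := by
  classical
  have h1 : ∀ s : Finset (Fin r), m (fun _ => ∑ i ∈ s, v i) =
      ∑ f : Fin r → Fin r, if ∀ j, f j ∈ s then m (v ∘ f) else 0 := by
    intro s
    rw [MultilinearMap.map_sum_finset m (fun _ i => v i) (fun _ => s), ← Finset.sum_filter]
    refine Finset.sum_congr ?_ fun _ _ => rfl
    ext f; simp [Fintype.mem_piFinset]
  -- Inclusion–exclusion: the sets `s` containing the image of `f` have as complements all subsets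
  -- of the complement of that image, and the alternating sum over these vanishes unless `f` is
  -- onto.
  have h2 : ∀ f : Fin r → Fin r,
      ∑ s : Finset (Fin r), (-1 : ℝ) ^ (sᶜ).card * (if ∀ j, f j ∈ s then m (v ∘ f) else 0) =
        if Function.Bijective f then m v else 0 := by
    intro f
    have h3 : ∑ s : Finset (Fin r), (-1 : ℝ) ^ (sᶜ).card * (if ∀ j, f j ∈ s then m (v ∘ f) else 0)
        = ∑ t ∈ ((Finset.univ.image f)ᶜ).powerset, (-1 : ℝ) ^ t.card * m (v ∘ f) := by
      simp only [mul_ite, mul_zero]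
      rw [← Finset.sum_filter]
      refine Finset.sum_bij (fun s _ => sᶜ) ?_ ?_ ?_ ?_
      · intro s hs
        simp only [Finset.mem_filter, Finset.mem_univ, true_and] at hs
        rw [Finset.mem_powerset, Finset.compl_subset_compl]
        intro i hi
        obtain ⟨j, -, rfl⟩ := Finset.mem_image.1 hi
        exact hs j
      · intro s _ t _ h; exact compl_injective h
      · intro t ht
        refine ⟨tᶜ, ?_, compl_compl t⟩
        simp only [Finset.mem_filter, Finset.mem_univ, true_and, Finset.mem_compl]
        intro j hj
        have := Finset.mem_powerset.1 ht hj
        simp at this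
      · intro s _; rfl
    rw [h3, ← Finset.sum_mul]
    have h4 := congrArg (Int.cast : ℤ → ℝ)
      (Finset.sum_powerset_neg_one_pow_card (x := (Finset.univ.image f)ᶜ))
    push_cast at h4
    rw [h4]
    have h5 : (Finset.univ.image f)ᶜ = ∅ ↔ Function.Bijective f := by
      rw [← Finite.surjective_iff_bijective, Finset.compl_eq_empty_iff]
      simp [Finset.eq_univ_iff_forall, Function.Surjective]
    by_cases hf : Function.Bijective f
    · rw [if_pos (h5.2 hf), if_pos hf, one_mul]
      exact hm (Equiv.ofBijective f hf) v
    · rw [if_neg (fun h => hf (h5.1 h)), if_neg hf, zero_mul]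
  simp only [h1, Finset.mul_sum]
  rw [Finset.sum_comm]
  simp only [h2]
  have h6 : (∑ f : Fin r → Fin r, if Function.Bijective f then m v else 0) =
      ∑ σ : Equiv.Perm (Fin r), m v := by
    rw [← Finset.sum_filter]
    symm
    refine Finset.sum_bij (fun σ _ => ⇑σ) ?_ ?_ ?_ ?_
    · intro σ _; exact Finset.mem_filter.2 ⟨Finset.mem_univ _, σ.bijective⟩
    · intro σ _ τ _ h; exact DFunLike.coe_injective h
    · intro f hf
      exact ⟨Equiv.ofBijective f ((Finset.mem_filter.1 hf).2), Finset.mem_univ _, rfl⟩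
    · intro _ _; rfl
  rw [h6]
  simp [Fintype.card_perm]

/-- A smooth homogeneous function of degree `r` on a normed space is the diagonal of its `r`-th
derivative at the origin, divided by `r!`. -/
theorem factorial_mul_eq_iteratedFDeriv_zero {V : Type*} [NormedAddCommGroup V] [NormedSpace ℝ V]
    {f : V → ℝ} (hf : ContDiff ℝ ∞ f) {r : ℕ} (h : ∀ (c : ℝ) (v : V), f (c • v) = c ^ r * f v)
    (v : V) : (r.factorial : ℝ) * f v = iteratedFDeriv ℝ r f 0 (fun _ => v) := by
  -- On the line `t ↦ t • v` the function is `t ^ r * f v`, whose `r`-th derivative at `0` is `r! *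
  -- f v`.
  have h1 := (ContinuousLinearMap.toSpanSingleton ℝ v).iteratedFDeriv_comp_right (i := r) hf 0
    (by exact_mod_cast le_top)
  have h2 := congrArg (fun p => p (fun _ => (1 : ℝ))) h1
  have h3 : f ∘ (ContinuousLinearMap.toSpanSingleton ℝ v) = fun t : ℝ => t ^ r * f v := by
    ext t; simp [h]
  rw [h3] at h2
  simp only [← iteratedDeriv_eq_iteratedFDeriv] at h2
  simp at h2
  rw [← h2, Nat.descFactorial_self]

/-- A smooth homogeneous function of degree `r` on a normed space is the diagonal of a symmetric
`r`-linear form, divided by `r!`. -/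
theorem exists_symmetric_diagonal_eq {V : Type*} [NormedAddCommGroup V] [NormedSpace ℝ V]
    {f : V → ℝ} (hf : ContDiff ℝ ∞ f) {r : ℕ} (h : ∀ (c : ℝ) (v : V), f (c • v) = c ^ r * f v) :
    ∃ m : MultilinearMap ℝ (fun _ : Fin r => V) ℝ,
      (∀ (σ : Equiv.Perm (Fin r)) (v : Fin r → V), m (v ∘ σ) = m v) ∧
      ∀ v, f v = (r.factorial : ℝ)⁻¹ * m (fun _ => v) := by
  have h1 : ∀ v, f v = (r.factorial : ℝ)⁻¹ * iteratedFDeriv ℝ r f 0 (fun _ => v) := by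
    intro v
    rw [← factorial_mul_eq_iteratedFDeriv_zero hf h v, inv_mul_cancel_left₀]
    exact_mod_cast r.factorial_ne_zero
  refine ⟨(iteratedFDeriv ℝ r f 0).toMultilinearMap, fun σ v => ?_, h1⟩
  -- By `h1` the function is the diagonal of a continuous multilinear map, hence analytic; this
  -- regularity is what the symmetry of the iterated derivative is drawn from.
  have h2 : ContDiff ℝ ω f := by
    rw [funext h1]
    exact contDiff_const.mul ((iteratedFDeriv ℝ r f 0).contDiff.comp
      (contDiff_pi.2 fun _ => contDiff_id))
  exact h2.contDiffAt.iteratedFDeriv_comp_perm v σ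

end

/-! ### Momenta of vector fields and local generation by them. -/

section

open Filter Topology

variable {E : Type*} [NormedAddCommGroup E] [NormedSpace ℝ E]
  {M : Type*} [TopologicalSpace M] [ChartedSpace E M] [IsManifold 𝓘(ℝ, E) ∞ M]

/-- The pull-back `f ∘ pr` of a smooth function on `M` to `T*M`. -/
def pullFun (f : SmoothFun E M) : SmoothFunCotangent E M :=
  ⟨fun ζ => f ζ.proj, f.contMDiff.comp (contMDiff_proj (fun x : M => CotangentSpace E x))⟩

@[simp]
theorem pullFun_apply (f : SmoothFun E M) (ζ : CotangentBundle E M) : pullFun f ζ = f ζ.proj := rfl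

/-- The momentum `ζ ↦ ζ(X)` of a smooth vector field, as a smooth function on `T*M`. -/
def momFun (X : SmoothVectorField E M) : SmoothFunCotangent E M :=
  ⟨momentum X, by
    intro ζ
    have h1 : ContMDiffAt (cotangentModel E) 𝓘(ℝ, E).tangent ∞
        (fun η : CotangentBundle E M => (⟨η.proj, X η.proj⟩ : TangentBundle 𝓘(ℝ, E) M)) ζ :=
      (X.contMDiff.comp (contMDiff_proj (fun x : M => CotangentSpace E x))) ζ
    have h2 : ContMDiffAt (cotangentModel E) (cotangentModel E) ∞
        (fun η : CotangentBundle E M => (⟨η.proj, η.snd⟩ : CotangentBundle E M)) ζ :=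
      contMDiffAt_id
    have h := ContMDiffAt.clm_bundle_apply (E₂ := Bundle.Trivial M ℝ) (F₂ := ℝ) h2 h1
    rw [contMDiffAt_totalSpace] at h
    exact h.2⟩

@[simp]
theorem momFun_apply (X : SmoothVectorField E M) (ζ : CotangentBundle E M) :
    momFun X ζ = ζ.snd (X ζ.proj) := rfl

/-- Finite sums of products of the pull-back of a function and `r` momenta of vector fields. -/
inductive IsMomentumPoly : ℕ → SmoothFunCotangent E M → Prop
  | zero (r : ℕ) : IsMomentumPoly r 0
  | pull (f : SmoothFun E M) : IsMomentumPoly 0 (pullFun f)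
  | mom_mul (r : ℕ) (X : SmoothVectorField E M) (G : SmoothFunCotangent E M) :
      IsMomentumPoly r G → IsMomentumPoly (r + 1) (momFun X * G)
  | add (r : ℕ) (F G : SmoothFunCotangent E M) :
      IsMomentumPoly r F → IsMomentumPoly r G → IsMomentumPoly r (F + G)

theorem IsMomentumPoly.prod_mul (f : SmoothFun E M) :
    ∀ (r : ℕ) (X : Fin r → SmoothVectorField E M),
      IsMomentumPoly r ((∏ j, momFun (X j)) * pullFun f)
  | 0, X => by simpa using IsMomentumPoly.pull f
  | r + 1, X => by
    rw [Fin.prod_univ_succ, mul_assoc]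
    exact .mom_mul r _ _ (IsMomentumPoly.prod_mul f r _)

theorem IsMomentumPoly.sum {ι : Type*} (s : Finset ι) {r : ℕ} (F : ι → SmoothFunCotangent E M)
    (h : ∀ i ∈ s, IsMomentumPoly r (F i)) : IsMomentumPoly r (∑ i ∈ s, F i) :=
  Finset.sum_induction F (IsMomentumPoly r) (fun _ _ => .add r _ _) (.zero r) h

section frames

variable [FiniteDimensional ℝ E] [T2Space M]

/-- A function that is smooth on a chart domain around `x₀` agrees near `x₀` with a smooth
function on `M`. -/
theorem exists_smoothFun_eventuallyEq (x₀ : M) {g : M → ℝ}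
    (hg : ContMDiffOn 𝓘(ℝ, E) 𝓘(ℝ, ℝ) ∞ g (chartAt E x₀).source) :
    ∃ f : SmoothFun E M, f =ᶠ[𝓝 x₀] g := by
  let φ : SmoothBumpFunction 𝓘(ℝ, E) x₀ := Classical.arbitrary _
  refine ⟨⟨fun x => φ x • g x, φ.contMDiff_smul hg⟩, ?_⟩
  filter_upwards [φ.eventuallyEq_one] with x hx
  change φ x • g x = g x
  simp [hx]

/-- Near each point there are a frame of vector fields and a dual frame of 1-forms. -/
theorem exists_dual_frames (x₀ : M) :
    ∃ (n : ℕ) (e : Fin n → SmoothVectorField E M) (θ : Fin n → Π x : M, CotangentSpace E x),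
      (∀ i, ∀ x ∈ (chartAt E x₀).source, SmoothOneFormAt (θ i) x) ∧
      ∀ᶠ x in 𝓝 x₀, ∀ ζ : CotangentSpace E x, ζ = ∑ i, ζ (e i x) • θ i x := by
  let φ : SmoothBumpFunction 𝓘(ℝ, E) x₀ := Classical.arbitrary _
  let t := trivializationAt E (TangentSpace 𝓘(ℝ, E) : M → Type _) x₀
  let b := Module.finBasis ℝ E
  have hb : t.baseSet = (chartAt E x₀).source := TangentBundle.trivializationAt_baseSet x₀
  have he : ∀ i, ContMDiff 𝓘(ℝ, E) 𝓘(ℝ, E).tangent ∞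
      (fun x => (⟨x, φ x • t.localFrame b i x⟩ : TangentBundle 𝓘(ℝ, E) M)) := by
    intro i
    refine ContMDiffOn.smul_section_of_tsupport (u := t.baseSet) φ.contMDiff.contMDiffOn
      t.open_baseSet (hb ▸ φ.tsupport_subset_chartAt_source)
      (t.contMDiffOn_localFrame_baseSet ∞ b i)
  -- Only the vector fields are cut off by `φ`. The coframe need only be smooth over the chart,
  -- because it enters later through coefficient functions that are themselves cut off.
  let θ : Fin (Module.finrank ℝ E) → Π x : M, CotangentSpace E x := fun i x =>
    (LinearMap.toContinuousLinearMap (b.coord i)).comp (t.continuousLinearMapAt ℝ x)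
  refine ⟨_, fun i => ⟨_, he i⟩, θ, fun i x hx => ?_, ?_⟩
  · let T := trivializationAt (E →L[ℝ] ℝ) (fun x : M => CotangentSpace E x) x₀
    have hT : T.baseSet = (chartAt E x₀).source := by
      simp only [T, hom_trivializationAt_baseSet]
      rw [TangentBundle.trivializationAt_baseSet]
      simp
    refine (T.contMDiffAt_section_iff (hT ▸ hx)).2 ?_
    refine (contMDiffAt_const (c := LinearMap.toContinuousLinearMap (b.coord i))).congr_of_eventuallyEq
      ?_
    filter_upwards [(chartAt E x₀).open_source.mem_nhds hx] with y hy
    have hyt : y ∈ t.baseSet := hb ▸ hy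
    have h1 := hom_trivializationAt_apply (σ := RingHom.id ℝ) (F₁ := E) (F₂ := ℝ)
      (E₁ := (TangentSpace 𝓘(ℝ, E) : M → Type _)) (E₂ := Bundle.Trivial M ℝ) x₀
      ⟨y, θ i y⟩
    refine (congrArg Prod.snd h1).trans ?_
    ext w
    simp only [ContinuousLinearMap.inCoordinates, ContinuousLinearMap.comp_apply]
    rw [Bundle.Trivialization.symmL_apply _ hyt]
    have h2 : t.continuousLinearMapAt ℝ y (t.symmL ℝ y w) = w := t.continuousLinearMapAt_symmL hyt w
    rw [Bundle.Trivialization.symmL_apply _ hyt] at h2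
    simp [θ, h2]
  · filter_upwards [φ.eventuallyEq_one, (chartAt E x₀).open_source.mem_nhds (mem_chart_source E x₀)]
      with x hx hxs ζ
    rw [← hb] at hxs
    ext v
    have h1 : ∀ i, (⟨_, he i⟩ : SmoothVectorField E M) x = t.symm x (b i) := by
      intro i
      change φ x • t.localFrame b i x = _
      rw [hx, t.localFrame_apply_of_mem_baseSet b hxs]
      simp [Bundle.Trivialization.basisAt]
    have h2 : t.symmL ℝ x (∑ i, b.repr (t.continuousLinearMapAt ℝ x v) i • b i) = v := by
      rw [b.sum_repr, t.symmL_continuousLinearMapAt hxs]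
    have h3 : ∀ i, t.symmL ℝ x (b i) = t.symm x (b i) :=
      fun i => Bundle.Trivialization.symmL_apply _ hxs _
    calc ζ v = ζ (t.symmL ℝ x (∑ i, b.repr (t.continuousLinearMapAt ℝ x v) i • b i)) := by rw [h2]
      _ = ∑ i, b.repr (t.continuousLinearMapAt ℝ x v) i * ζ (t.symm x (b i)) := by
        rw [map_sum, map_sum]
        simp [h3]
      _ = _ := by
        simp only [h1]
        rw [sum_apply]
        refine Finset.sum_congr rfl fun i _ => ?_
        rw [mul_comm]
        rfl

/-- Near each point, the function `ζ ↦ X(ζ, …, ζ)` of a symmetric multivector field is a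
polynomial in momenta of vector fields. -/
theorem exists_isMomentumPoly {r : ℕ} (X : SymMultivectorField E M r) (x₀ : M) :
    ∃ G : SmoothFunCotangent E M, IsMomentumPoly r G ∧
      ∀ᶠ x in 𝓝 x₀, ∀ ζ : CotangentSpace E x, X.1 x (fun _ => ζ) = G ⟨x, ζ⟩ := by
  obtain ⟨n, e, θ, hθ, hζ⟩ := exists_dual_frames (E := E) x₀
  have hf : ∀ I : Fin r → Fin n, ∃ f : SmoothFun E M,
      f =ᶠ[𝓝 x₀] fun x => X.1 x (fun j => θ (I j) x) := fun I =>
    exists_smoothFun_eventuallyEq x₀ fun x hx =>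
      (X.2.2 x (fun j => θ (I j)) fun j => hθ (I j) x hx).contMDiffWithinAt
  choose f hf using hf
  refine ⟨∑ I : Fin r → Fin n, (∏ j, momFun (e (I j))) * pullFun (f I),
    .sum _ _ fun I _ => .prod_mul _ _ _, ?_⟩
  filter_upwards [hζ, eventually_all.2 hf] with x hx hfx ζ
  -- Multilinear expansion in the coframe: the monomials are products of momenta of the frame, with
  -- coefficients `X (θ (I 0), …)`.
  have h1 : X.1 x (fun _ => ζ) = X.1 x (fun _ => ∑ i, ζ (e i x) • θ i x) := by rw [← hx ζ]
  rw [h1, MultilinearMap.map_sum]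
  have h2 : ∀ s : Finset (Fin r → Fin n), (∑ I ∈ s, (∏ j, momFun (e (I j))) * pullFun (f I) :
      SmoothFunCotangent E M) ⟨x, ζ⟩ = ∑ I ∈ s, (∏ j, ζ (e (I j) x)) * f I x := by
    intro s
    have := map_sum (ContMDiffMap.evalRingHom (n := ∞) (⟨x, ζ⟩ : CotangentBundle E M))
      (fun I => (∏ j, momFun (e (I j))) * pullFun (f I)) s
    simp only [map_mul, map_prod] at this
    exact this
  rw [h2]
  refine Finset.sum_congr rfl fun I _ => ?_
  rw [MultilinearMap.map_smul_univ, hfx I, smul_eq_mul]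

end frames

end

/-! ### The vertical lift as a linear isomorphism compatible with products. -/

section

open Filter Topology

variable {E : Type*} [NormedAddCommGroup E] [NormedSpace ℝ E]
  {M : Type*} [TopologicalSpace M] [ChartedSpace E M] [IsManifold 𝓘(ℝ, E) ∞ M]

theorem eventually_proj {p : M → Prop} {ζ : CotangentBundle E M} (h : ∀ᶠ x in 𝓝 ζ.proj, p x) :
    ∀ᶠ η : CotangentBundle E M in 𝓝 ζ, p η.proj :=
  (FiberBundle.continuous_proj (E →L[ℝ] ℝ) (fun x : M => CotangentSpace E x)).continuousAt.eventually
    h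

/-- The restriction of a smooth function on `T*M` to a fibre is smooth. -/
theorem contDiff_fiber (F : SmoothFunCotangent E M) (x : M) :
    ContDiff ℝ ∞ (fun ζ : E →L[ℝ] ℝ => F ⟨x, ζ⟩) := by
  rw [← contMDiff_iff_contDiff]
  have h : ContMDiff 𝓘(ℝ, E →L[ℝ] ℝ) (cotangentModel E) ∞
      (fun ζ : E →L[ℝ] ℝ => (⟨x, ζ⟩ : CotangentBundle E M)) := by
    intro ζ
    rw [contMDiffAt_totalSpace]
    refine ⟨contMDiffAt_const, ?_⟩
    -- Read in the trivialization, the inclusion of the fibre is a continuous linear map.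
    let T := trivializationAt (E →L[ℝ] ℝ) (fun x : M => CotangentSpace E x) x
    let L : (E →L[ℝ] ℝ) →L[ℝ] (E →L[ℝ] ℝ) := T.continuousLinearMapAt ℝ x
    refine (L.contMDiff ζ).congr_of_eventuallyEq (Eventually.of_forall fun η => ?_)
    have := Bundle.Trivialization.coe_linearMapAt_of_mem (R := ℝ) T
      (FiberBundle.mem_baseSet_trivializationAt' x)
    exact (congrFun this η).symm
  exact F.contMDiff.comp h

theorem SymMultivectorField.eq_of_diagonal_eq {r : ℕ} {X Y : SymMultivectorField E M r}
    (h : ∀ (x : M) (ζ : CotangentSpace E x), X.1 x (fun _ => ζ) = Y.1 x (fun _ => ζ)) : X = Y := by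
  refine Subtype.ext (funext fun x => MultilinearMap.ext fun v => ?_)
  have hr : (r.factorial : ℝ) ≠ 0 := by exact_mod_cast r.factorial_ne_zero
  refine mul_left_cancel₀ hr ?_
  rw [factorial_mul_eq_sum_diagonal _ (X.2.1 x), factorial_mul_eq_sum_diagonal _ (Y.2.1 x)]
  simp only [h]

/-- Every polynomial in momenta of degree `r` is the diagonal of a symmetric multivector field. -/
theorem exists_symMultivectorField {r : ℕ} {F : SmoothFunCotangent E M} (hF : F ∈ PolDeg E M r) :
    ∃ X : SymMultivectorField E M r, ∀ (x : M) (ζ : CotangentSpace E x),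
      F ⟨x, ζ⟩ = (r.factorial : ℝ)⁻¹ * X.1 x (fun _ => ζ) := by
  have hr : (r.factorial : ℝ) ≠ 0 := by exact_mod_cast r.factorial_ne_zero
  have h1 : ∀ x : M, ∃ m : MultilinearMap ℝ (fun _ : Fin r => CotangentSpace E x) ℝ,
      (∀ (σ : Equiv.Perm (Fin r)) (v : Fin r → CotangentSpace E x), m (v ∘ σ) = m v) ∧
      ∀ ζ : CotangentSpace E x, F ⟨x, ζ⟩ = (r.factorial : ℝ)⁻¹ * m (fun _ => ζ) := fun x =>
    exists_symmetric_diagonal_eq (contDiff_fiber F x) fun c v => hF c x v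
  choose m hm hm' using h1
  refine ⟨⟨m, hm, fun x α hα => ?_⟩, hm'⟩
  -- The forms `m y` were chosen point by point, so their smooth dependence on `y` is not yet known.
  -- Polarization expresses them through `F` along sums of the 1-forms, where smoothness is visible.
  have h2 : (fun y => m y fun i => α i y) = fun y => ∑ s : Finset (Fin r),
      (-1 : ℝ) ^ (sᶜ).card * F ⟨y, ∑ i ∈ s, α i y⟩ := by
    funext y
    refine mul_left_cancel₀ hr ?_
    rw [factorial_mul_eq_sum_diagonal _ (hm y), Finset.mul_sum]
    refine Finset.sum_congr rfl fun s _ => ?_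
    rw [hm']
    field_simp
  rw [h2]
  refine ContMDiffAt.sum fun s _ => contMDiffAt_const.mul ?_
  refine (F.contMDiff _).comp x (g := F) ?_
  exact ContMDiffAt.sum_section fun i _ => hα i

section lift

variable [FiniteDimensional ℝ E] [T2Space M]

/-- The vertical lift of a homogeneous symmetric multivector field. -/
def liftFun (r : ℕ) (X : SymMultivectorField E M r) : SmoothFunCotangent E M :=
  ⟨fun ζ => (r.factorial : ℝ)⁻¹ * X.1 ζ.proj (fun _ => ζ.snd), by
    intro ζ
    obtain ⟨G, -, hG⟩ := exists_isMomentumPoly X ζ.proj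
    refine contMDiffAt_const.mul ((G.contMDiff ζ).congr_of_eventuallyEq ?_)
    filter_upwards [eventually_proj hG] with η hη
    exact hη η.snd⟩

/-- The vertical lift of homogeneous symmetric multivector fields, as a linear map. -/
def liftHom (r : ℕ) : SymMultivectorField E M r →ₗ[ℝ] SmoothFunCotangent E M where
  toFun := liftFun r
  map_add' X Y := by
    refine ContMDiffMap.ext fun ζ => ?_
    change (r.factorial : ℝ)⁻¹ * (X.1 ζ.proj (fun _ => ζ.snd) + Y.1 ζ.proj (fun _ => ζ.snd)) =
      (r.factorial : ℝ)⁻¹ * X.1 ζ.proj (fun _ => ζ.snd) +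
        (r.factorial : ℝ)⁻¹ * Y.1 ζ.proj (fun _ => ζ.snd)
    ring
  map_smul' c X := by
    refine ContMDiffMap.ext fun ζ => ?_
    change (r.factorial : ℝ)⁻¹ * (c * X.1 ζ.proj (fun _ => ζ.snd)) =
      c * ((r.factorial : ℝ)⁻¹ * X.1 ζ.proj (fun _ => ζ.snd))
    ring

theorem liftHom_apply (r : ℕ) (X : SymMultivectorField E M r) (ζ : CotangentBundle E M) :
    liftHom r X ζ = (r.factorial : ℝ)⁻¹ * X.1 ζ.proj (fun _ => ζ.snd) := rfl

theorem liftHom_injective (r : ℕ) : Function.Injective (liftHom (E := E) (M := M) r) := by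
  intro X Y h
  refine SymMultivectorField.eq_of_diagonal_eq fun x ζ => ?_
  have h1 := congrArg (fun F => F (⟨x, ζ⟩ : CotangentBundle E M)) h
  simp only [liftHom_apply] at h1
  exact mul_left_cancel₀ (inv_ne_zero (by exact_mod_cast r.factorial_ne_zero)) h1

theorem range_liftHom (r : ℕ) : LinearMap.range (liftHom (E := E) (M := M) r) = PolDeg E M r := by
  refine le_antisymm ?_ ?_
  · rintro _ ⟨X, rfl⟩ c x ζ
    simp only [liftHom_apply]
    have h1 := (X.1 x).map_smul_univ (fun _ => c) (fun _ => ζ)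
    simp only [Finset.prod_const, Finset.card_univ, Fintype.card_fin, smul_eq_mul] at h1
    rw [h1]
    ring
  · intro F hF
    obtain ⟨X, hX⟩ := exists_symMultivectorField hF
    exact ⟨X, ContMDiffMap.ext fun ζ => (hX ζ.proj ζ.snd).symm⟩

variable (E M) in
/-- The vertical lift, as a linear map to the smooth functions on `T*M`. -/
def liftAll : SymMultivectorFields E M →ₗ[ℝ] SmoothFunCotangent E M :=
  DirectSum.toModule ℝ ℕ _ liftHom

@[simp]
theorem liftAll_incl (r : ℕ) (X : SymMultivectorField E M r) :
    liftAll E M (incl r X) = liftHom r X := by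
  simp [liftAll, incl]

theorem liftAll_apply (X : SymMultivectorFields E M) (ζ : CotangentBundle E M) :
    liftAll E M X ζ = verticalLift X ζ := by
  induction X using DirectSum.induction_on with
  | zero => simp [verticalLift]
  | of r X => exact (congrArg (fun F => F ζ) (liftAll_incl r X)).trans (verticalLift_incl r X ζ).symm
  | add X Y hX hY =>
    have h : verticalLift (X + Y) ζ = verticalLift X ζ + verticalLift Y ζ := map_add _ X Y
    rw [h, ← hX, ← hY, map_add]
    rfl

/-- Scaling the covector weights the degree-`r` part by `c ^ r`, which is the device for separating
the degrees. -/
theorem liftAll_smul_apply (X : SymMultivectorFields E M) : ∃ s : Finset ℕ,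
    X = ∑ r ∈ s, incl r (X r) ∧ ∀ (c : ℝ) (x : M) (ζ : CotangentSpace E x),
      liftAll E M X ⟨x, c • ζ⟩ = ∑ r ∈ s, c ^ r * liftHom r (X r) ⟨x, ζ⟩ := by
  classical
  have h := (DirectSum.sum_support_of X).symm
  refine ⟨_, h, fun c x ζ => ?_⟩
  have h1 := congrArg (fun Y => ContMDiffMap.evalRingHom (n := ∞)
    (⟨x, c • ζ⟩ : CotangentBundle E M) (liftAll E M Y)) h
  simp only [map_sum] at h1
  refine h1.trans (Finset.sum_congr rfl fun r _ => ?_)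
  have h2 : liftHom r (X r) ∈ PolDeg E M r := range_liftHom (E := E) (M := M) r ▸ ⟨X r, rfl⟩
  rw [← h2 c x ζ]
  exact congrArg (fun F : SmoothFunCotangent E M => F ⟨x, c • ζ⟩) (liftAll_incl r (X r))

theorem liftAll_injective : Function.Injective (liftAll E M) := by
  let _ : AddCommGroup (SymMultivectorFields E M) := Module.addCommMonoidToAddCommGroup ℝ
  refine (injective_iff_map_eq_zero (liftAll E M)).2 fun X hX => ?_
  obtain ⟨s, hs, h⟩ := liftAll_smul_apply X
  rw [hs]
  refine Finset.sum_eq_zero fun r hr => ?_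
  have h1 : liftHom r (X r) = 0 := by
    refine ContMDiffMap.ext fun ζ => ?_
    -- With `ζ` fixed, the value at `c • ζ` is a polynomial in `c` that vanishes for all real `c`,
    -- so each coefficient is zero.
    let p : Polynomial ℝ := ∑ k ∈ s, Polynomial.monomial k (liftHom k (X k) ζ)
    have hp : p = 0 := by
      refine Polynomial.funext fun c => ?_
      have h2 := h c ζ.proj ζ.snd
      rw [hX] at h2
      simp only [p, Polynomial.eval_finsetSum, Polynomial.eval_monomial, Polynomial.eval_zero]
      refine Eq.trans (Finset.sum_congr rfl fun k _ => mul_comm _ _) h2.symm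
    have h3 := congrArg (fun q => q.coeff r) hp
    simp only [p, Polynomial.finsetSum_coeff, Polynomial.coeff_monomial, Finset.sum_ite_eq', hr,
      if_true, Polynomial.coeff_zero] at h3
    exact h3
  rw [liftHom_injective r (h1.trans (map_zero _).symm)]
  exact map_zero _

theorem range_liftAll : LinearMap.range (liftAll E M) = Pol E M := by
  refine le_antisymm ?_ (iSup_le fun r => ?_)
  · rintro _ ⟨X, rfl⟩
    induction X using DirectSum.induction_on with
    | zero => simp
    | of r X =>
      have h : liftHom r X ∈ PolDeg E M r := range_liftHom (E := E) (M := M) r ▸ ⟨X, rfl⟩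
      have h' := liftAll_incl r X
      exact h' ▸ (le_iSup (PolDeg E M) r) h
    | add X Y hX hY => rw [map_add]; exact add_mem hX hY
  · rw [← range_liftHom]
    rintro _ ⟨X, rfl⟩
    exact ⟨incl r X, liftAll_incl r X⟩

/-- On the diagonal all `(r + s)!` permutations contribute the same term, which cancels the factor
`1/(r + s)!` of the lift and leaves `1/(r! s!)`. -/
theorem liftHom_symProdHom {r s : ℕ} (X : SymMultivectorField E M r)
    (Y : SymMultivectorField E M s) :
    liftHom (r + s) (symProdHom E M r s X Y) = liftHom r X * liftHom s Y := by
  refine ContMDiffMap.ext fun ζ => ?_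
  have h1 : (symProdHom E M r s X Y).1 ζ.proj (fun _ => ζ.snd) =
    symProdForm (X.1 ζ.proj) (Y.1 ζ.proj) (fun _ => ζ.snd) := rfl
  have h2 : (liftHom r X * liftHom s Y) ζ = liftHom r X ζ * liftHom s Y ζ := rfl
  rw [h2]
  simp only [liftHom_apply]
  rw [h1, symProdForm_apply]
  simp only [Finset.sum_const, Finset.card_univ, Fintype.card_perm, Fintype.card_fin, nsmul_eq_mul]
  have hr : ((r + s).factorial : ℝ) ≠ 0 := by exact_mod_cast (r + s).factorial_ne_zero
  field_simp

theorem liftAll_symProd (X Y : SymMultivectorFields E M) :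
    liftAll E M (symProd E M X Y) = liftAll E M X * liftAll E M Y := by
  induction X using DirectSum.induction_on with
  | zero => simp
  | add X X' hX hX' => simp only [map_add, LinearMap.add_apply, hX, hX', add_mul]
  | of r X =>
    induction Y using DirectSum.induction_on with
    | zero => simp
    | add Y Y' hY hY' => simp only [map_add, hY, hY', mul_add]
    | of s Y =>
      have h := congrArg (liftAll E M) (symProd_incl r s X Y)
      rw [liftAll_incl, liftHom_symProdHom, ← liftAll_incl, ← liftAll_incl] at h
      exact h

theorem liftAll_ofFun (f : SmoothFun E M) : liftAll E M (incl 0 (ofFun f)) = pullFun f := by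
  rw [liftAll_incl]
  refine ContMDiffMap.ext fun ζ => ?_
  simp [liftHom_apply, ofFun]

theorem liftAll_ofVec (X : SmoothVectorField E M) :
    liftAll E M (incl 1 (ofVec X)) = momFun X := by
  rw [liftAll_incl]
  refine ContMDiffMap.ext fun ζ => ?_
  simp [liftHom_apply, ofVec_apply]

variable (E M) in
/-- The vertical lift is a linear isomorphism from the symmetric multivector fields onto the
polynomials in momenta. -/
def liftEquiv : SymMultivectorFields E M ≃ₗ[ℝ] Pol E M :=
  (LinearEquiv.ofInjective (liftAll E M) liftAll_injective).trans
    (LinearEquiv.ofEq _ _ range_liftAll)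

end lift

end

/-! ### Algebraic rules for the Patterson–Walker bracket and its values on generators. -/

section

open Filter Topology

variable {E : Type*} [NormedAddCommGroup E] [NormedSpace ℝ E]
  {M : Type*} [TopologicalSpace M] [ChartedSpace E M] [IsManifold 𝓘(ℝ, E) ∞ M]
  [FiniteDimensional ℝ E]

section pointwise

variable (nabla : CovariantDerivative 𝓘(ℝ, E) E (TangentSpace 𝓘(ℝ, E) : M → Type _))

theorem pwMetric_apply (ζ : CotangentBundle E M) (u w : TangentSpace (cotangentModel E) ζ) :
    pwMetric nabla ζ u w =
      connector nabla ζ u (projDeriv ζ w) + connector nabla ζ w (projDeriv ζ u) := rfl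

theorem pwMetric_comm (ζ : CotangentBundle E M) (u w : TangentSpace (cotangentModel E) ζ) :
    pwMetric nabla ζ u w = pwMetric nabla ζ w u := by
  rw [pwMetric_apply, pwMetric_apply, add_comm]

theorem pwMetric_pwGrad (F : CotangentBundle E M → ℝ) (ζ : CotangentBundle E M)
    (w : TangentSpace (cotangentModel E) ζ) :
    pwMetric nabla ζ (pwGrad nabla F ζ) w = mvfderiv (cotangentModel E) F ζ w :=
  LinearMap.BilinForm.apply_toDual_symm_apply ..

theorem pwBracket_eq (F G : CotangentBundle E M → ℝ) (ζ : CotangentBundle E M) :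
    pwBracket nabla F G ζ = pwMetric nabla ζ (pwGrad nabla G ζ) (pwGrad nabla F ζ) :=
  (pwMetric_pwGrad nabla G ζ _).symm

theorem pwBracket_comm (F G : CotangentBundle E M → ℝ) (ζ : CotangentBundle E M) :
    pwBracket nabla F G ζ = pwBracket nabla G F ζ := by
  rw [pwBracket_eq, pwBracket_eq, pwMetric_comm]

theorem mdifferentiableAt_coe (F : SmoothFunCotangent E M) (ζ : CotangentBundle E M) :
    MDifferentiableAt (cotangentModel E) 𝓘(ℝ, ℝ) F ζ :=
  (F.contMDiff ζ).mdifferentiableAt (by simp)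

theorem pwBracket_add_right (F : CotangentBundle E M → ℝ) (G H : SmoothFunCotangent E M)
    (ζ : CotangentBundle E M) :
    pwBracket nabla F (G + H : SmoothFunCotangent E M) ζ =
      pwBracket nabla F G ζ + pwBracket nabla F H ζ := by
  simp only [pwBracket, ContMDiffMap.coe_add]
  rw [mvfderiv_add (mdifferentiableAt_coe G ζ) (mdifferentiableAt_coe H ζ)]
  rfl

theorem pwBracket_mul_right (F : CotangentBundle E M → ℝ) (G H : SmoothFunCotangent E M)
    (ζ : CotangentBundle E M) :
    pwBracket nabla F (G * H : SmoothFunCotangent E M) ζ =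
      G ζ * pwBracket nabla F H ζ + H ζ * pwBracket nabla F G ζ := by
  simp only [pwBracket, ContMDiffMap.coe_mul]
  rw [mvfderiv_mul (mdifferentiableAt_coe G ζ) (mdifferentiableAt_coe H ζ)]
  rfl

theorem pwBracket_zero_right (F : CotangentBundle E M → ℝ) (ζ : CotangentBundle E M) :
    pwBracket nabla F (0 : SmoothFunCotangent E M) ζ = 0 := by
  have := pwBracket_add_right nabla F 0 0 ζ
  rw [add_zero] at this
  linarith

theorem pwBracket_smul_right (F : CotangentBundle E M → ℝ) (c : ℝ) (G : SmoothFunCotangent E M)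
    (ζ : CotangentBundle E M) :
    pwBracket nabla F (c • G : SmoothFunCotangent E M) ζ = c * pwBracket nabla F G ζ := by
  -- A scalar is a pulled-back constant function, so homogeneity follows from the Leibniz rule.
  have h1 : c • G = pullFun (⟨fun _ => c, contMDiff_const⟩ : SmoothFun E M) * G := rfl
  have h2 : mvfderiv (cotangentModel E)
      (pullFun (⟨fun _ => c, contMDiff_const⟩ : SmoothFun E M)) ζ = 0 := mvfderiv_const c
  rw [h1, pwBracket_mul_right]
  simp only [pwBracket, h2, zero_apply, mul_zero, add_zero]
  rfl

theorem pwBracket_congr {F F' G G' : CotangentBundle E M → ℝ} {ζ : CotangentBundle E M}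
    (hF : F =ᶠ[𝓝 ζ] F') (hG : G =ᶠ[𝓝 ζ] G') :
    pwBracket nabla F G ζ = pwBracket nabla F' G' ζ := by
  have h1 : mvfderiv (cotangentModel E) F ζ = mvfderiv (cotangentModel E) F' ζ := by
    simp only [mvfderiv, hF.mfderiv_eq]; rfl
  have h2 : mvfderiv (cotangentModel E) G ζ = mvfderiv (cotangentModel E) G' ζ := by
    simp only [mvfderiv, hG.mfderiv_eq]; rfl
  simp only [pwBracket, pwGrad, h1, h2]

/-- The metric pairs the horizontal part of one vector with the vertical part of the other. The
splitting is onto, so some vector has parts `X` and `α`; by nondegeneracy it is the gradient. -/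
theorem pwGrad_eq {F : CotangentBundle E M → ℝ} {ζ : CotangentBundle E M}
    {X : TangentSpace 𝓘(ℝ, E) ζ.proj} {α : CotangentSpace E ζ.proj}
    (h : ∀ w, mvfderiv (cotangentModel E) F ζ w = α (projDeriv ζ w) + connector nabla ζ w X) :
    projDeriv ζ (pwGrad nabla F ζ) = X ∧ connector nabla ζ (pwGrad nabla F ζ) = α := by
  obtain ⟨u, hu⟩ := (splittingMap_bijective nabla ζ).2 (X, α)
  have h1 : projDeriv ζ u = X := congrArg Prod.fst hu
  have h2 : connector nabla ζ u = α := congrArg Prod.snd hu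
  have h3 : pwGrad nabla F ζ = u := by
    refine ((pwMetric nabla ζ).toDual (pwMetric_nondegenerate nabla ζ)).injective ?_
    refine LinearMap.ext fun w => ?_
    rw [LinearMap.BilinForm.toDual_def, LinearMap.BilinForm.toDual_def, pwMetric_pwGrad,
      pwMetric_apply, h1, h2, h]
  rw [h3]
  exact ⟨h1, h2⟩

theorem mvfderiv_pullFun (f : SmoothFun E M) (ζ : CotangentBundle E M)
    (w : TangentSpace (cotangentModel E) ζ) :
    mvfderiv (cotangentModel E) (pullFun f) ζ w =
      mvfderiv 𝓘(ℝ, E) f ζ.proj (projDeriv ζ w) :=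
  mvfderiv_comp_apply ζ ((f.contMDiff _).mdifferentiableAt (by simp))
    (mdifferentiableAt_proj (fun x : M => CotangentSpace E x)) w

/-- This is the defining equation of the connector rearranged into the shape that `pwGrad_eq`
expects: the gradient has horizontal part `X` and vertical part `ζ ∘ ∇X`. -/
theorem mvfderiv_momFun (X : SmoothVectorField E M) (ζ : CotangentBundle E M)
    (w : TangentSpace (cotangentModel E) ζ) :
    mvfderiv (cotangentModel E) (momFun X) ζ w =
      ζ.snd (nabla X ζ.proj (projDeriv ζ w)) + connector nabla ζ w (X ζ.proj) := by
  rw [connector_apply nabla ζ w ((X.contMDiff _).mdifferentiableAt (by simp))]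
  change _ = _ + (mvfderiv (cotangentModel E) (momFun X) ζ w - _)
  ring

theorem pwGrad_pullFun (f : SmoothFun E M) (ζ : CotangentBundle E M) :
    projDeriv ζ (pwGrad nabla (pullFun f) ζ) = 0 ∧
      connector nabla ζ (pwGrad nabla (pullFun f) ζ) = mvfderiv 𝓘(ℝ, E) f ζ.proj :=
  pwGrad_eq nabla fun w => by rw [mvfderiv_pullFun, map_zero, add_zero]

theorem pwBracket_pullFun_pullFun (f g : SmoothFun E M) (ζ : CotangentBundle E M) :
    pwBracket nabla (pullFun f) (pullFun g) ζ = 0 := by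
  rw [pwBracket, mvfderiv_pullFun, (pwGrad_pullFun nabla f ζ).1, map_zero]

theorem pwBracket_momFun_pullFun (X : SmoothVectorField E M) (f : SmoothFun E M)
    (ζ : CotangentBundle E M) :
    pwBracket nabla (momFun X) (pullFun f) ζ = pullFun (lieDeriv X f) ζ := by
  rw [pwBracket_comm, pwBracket, mvfderiv_momFun nabla, (pwGrad_pullFun nabla f ζ).1,
    (pwGrad_pullFun nabla f ζ).2, map_zero, map_zero, zero_add]
  rfl

/-- Evaluating the differential of the momentum of `Y` on the gradient of that of `X` gives `ζ(∇_X
Y)` from the horizontal part and `ζ(∇_Y X)` from the vertical part. -/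
theorem pwBracket_momFun_momFun [CovariantDerivative.ContMDiffCovariantDerivative nabla ∞]
    (X Y : SmoothVectorField E M) (ζ : CotangentBundle E M) :
    pwBracket nabla (momFun X) (momFun Y) ζ = momFun (symBracket nabla X Y) ζ := by
  have h := pwGrad_eq nabla (F := momFun X) (ζ := ζ) (X := X ζ.proj)
    (α := ζ.snd.comp (nabla X ζ.proj)) (mvfderiv_momFun nabla X ζ)
  rw [pwBracket, mvfderiv_momFun nabla, h.1, h.2]
  exact (map_add ζ.snd _ _).symm

end pointwise

end

/-! ### Closure of the polynomials in momenta under the bracket. -/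

section

open Filter Topology

variable {E : Type*} [NormedAddCommGroup E] [NormedSpace ℝ E]
  {M : Type*} [TopologicalSpace M] [ChartedSpace E M] [IsManifold 𝓘(ℝ, E) ∞ M]

variable (E M) in
/-- The polynomials in momenta of degree `n - 1`, which are zero for `n = 0`. -/
def PolShift : ℕ → Submodule ℝ (SmoothFunCotangent E M)
  | 0 => ⊥
  | n + 1 => PolDeg E M n

theorem mul_mem_polDeg {r s : ℕ} {F G : SmoothFunCotangent E M} (hF : F ∈ PolDeg E M r)
    (hG : G ∈ PolDeg E M s) : F * G ∈ PolDeg E M (r + s) := by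
  intro c x ζ
  change F _ * G _ = _ * (F _ * G _)
  rw [hF, hG]
  ring

theorem mul_mem_polShift {r n : ℕ} {F G : SmoothFunCotangent E M} (hF : F ∈ PolDeg E M r)
    (hG : G ∈ PolShift E M n) : F * G ∈ PolShift E M (r + n) := by
  cases n with
  | zero =>
    rw [(Submodule.mem_bot ℝ).1 hG, mul_zero]
    exact zero_mem _
  | succ n => exact mul_mem_polDeg hF hG

theorem polShift_le_pol (n : ℕ) : PolShift E M n ≤ Pol E M := by
  cases n with
  | zero => exact bot_le
  | succ n => exact le_iSup (PolDeg E M) n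

theorem pullFun_mem (f : SmoothFun E M) : pullFun f ∈ PolDeg E M 0 := by
  intro c x ζ; simp

theorem momFun_mem (X : SmoothVectorField E M) : momFun X ∈ PolDeg E M 1 := by
  intro c x ζ; simp

theorem IsMomentumPoly.mem {r : ℕ} {F : SmoothFunCotangent E M} (h : IsMomentumPoly r F) :
    F ∈ PolDeg E M r := by
  induction h with
  | zero r => exact zero_mem _
  | pull f => exact pullFun_mem f
  | mom_mul r X G _ ih => exact add_comm r 1 ▸ mul_mem_polDeg (momFun_mem X) ih
  | add r F G _ _ hF hG => exact add_mem hF hG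

/-- A function on `T*M` that agrees locally over `M` with polynomials in momenta of a given degree
is one. -/
theorem exists_mem_polShift_of_eventually {n : ℕ} {B : CotangentBundle E M → ℝ}
    (h : ∀ x₀ : M, ∃ H ∈ PolShift E M n,
      ∀ᶠ x in 𝓝 x₀, ∀ ζ : CotangentSpace E x, B ⟨x, ζ⟩ = H ⟨x, ζ⟩) :
    ∃ H ∈ PolShift E M n, ∀ ζ, H ζ = B ζ := by
  have hB : ContMDiff (cotangentModel E) 𝓘(ℝ, ℝ) ∞ B := by
    intro ζ
    obtain ⟨H, -, hH⟩ := h ζ.proj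
    refine (H.contMDiff ζ).congr_of_eventuallyEq ?_
    filter_upwards [eventually_proj hH] with η hη
    exact hη η.snd
  refine ⟨⟨B, hB⟩, ?_, fun _ => rfl⟩
  cases n with
  | zero =>
    refine (Submodule.mem_bot ℝ).2 (ContMDiffMap.ext fun ζ => ?_)
    obtain ⟨H, hH', hH⟩ := h ζ.proj
    rw [(Submodule.mem_bot ℝ).1 hH'] at hH
    exact hH.self_of_nhds ζ.snd
  | succ n =>
    intro c x ζ
    -- Homogeneity compares values within a single fibre, so one local representative is enough.
    obtain ⟨H, hH', hH⟩ := h x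
    have h1 := hH.self_of_nhds
    change B _ = _ * B _
    rw [h1, h1]
    exact hH' c x ζ

variable [FiniteDimensional ℝ E] [T2Space M]

theorem exists_isMomentumPoly_of_mem {r : ℕ} {F : SmoothFunCotangent E M} (hF : F ∈ PolDeg E M r)
    (x₀ : M) : ∃ G : SmoothFunCotangent E M, IsMomentumPoly r G ∧
      ∀ᶠ x in 𝓝 x₀, ∀ ζ : CotangentSpace E x, F ⟨x, ζ⟩ = G ⟨x, ζ⟩ := by
  obtain ⟨X, hX⟩ := exists_symMultivectorField hF
  obtain ⟨G, hG, h⟩ := exists_isMomentumPoly ((r.factorial : ℝ)⁻¹ • X) x₀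
  refine ⟨G, hG, h.mono fun x hx ζ => ?_⟩
  rw [← hx, hX]
  rfl

section bracket

variable (nabla : CovariantDerivative 𝓘(ℝ, E) E (TangentSpace 𝓘(ℝ, E) : M → Type _))

theorem pwBracket_congr_over {F F' G G' : CotangentBundle E M → ℝ} {x : M}
    (hF : ∀ᶠ y in 𝓝 x, ∀ ζ : CotangentSpace E y, F ⟨y, ζ⟩ = F' ⟨y, ζ⟩)
    (hG : ∀ᶠ y in 𝓝 x, ∀ ζ : CotangentSpace E y, G ⟨y, ζ⟩ = G' ⟨y, ζ⟩) (ζ : CotangentSpace E x) :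
    pwBracket nabla F G ⟨x, ζ⟩ = pwBracket nabla F' G' ⟨x, ζ⟩ := by
  refine pwBracket_congr nabla ?_ ?_
  · filter_upwards [eventually_proj (ζ := (⟨x, ζ⟩ : CotangentBundle E M)) hF] with η hη
    exact hη η.snd
  · filter_upwards [eventually_proj (ζ := (⟨x, ζ⟩ : CotangentBundle E M)) hG] with η hη
    exact hη η.snd

/-- The Patterson–Walker bracket of `F` and `G` is a polynomial in momenta of degree `n - 1`. -/
def HasPolBracket (n : ℕ) (F G : SmoothFunCotangent E M) : Prop :=
  ∃ H ∈ PolShift E M n, ∀ ζ, H ζ = pwBracket nabla F G ζ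

variable {nabla}

theorem HasPolBracket.symm {n : ℕ} {F G : SmoothFunCotangent E M}
    (h : HasPolBracket nabla n F G) : HasPolBracket nabla n G F := by
  obtain ⟨H, hH, h⟩ := h
  exact ⟨H, hH, fun ζ => by rw [h, pwBracket_comm]⟩

/-- Induction by the Leibniz rule in the second argument; both summands of the product rule have the
same shifted degree. -/
theorem HasPolBracket.of_generators {r : ℕ} {F : SmoothFunCotangent E M}
    (h0 : ∀ f, HasPolBracket nabla r F (pullFun f))
    (h1 : ∀ X, HasPolBracket nabla (r + 1) F (momFun X)) {s : ℕ} {G : SmoothFunCotangent E M}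
    (hG : IsMomentumPoly s G) : HasPolBracket nabla (r + s) F G := by
  induction hG with
  | zero s => exact ⟨0, zero_mem _, fun ζ => (pwBracket_zero_right nabla F ζ).symm⟩
  | pull f => exact h0 f
  | mom_mul s X G hG ih =>
    obtain ⟨H, hH, h⟩ := ih
    obtain ⟨K, hK, k⟩ := h1 X
    refine ⟨momFun X * H + G * K, add_mem ?_ ?_, fun ζ => ?_⟩
    · have := mul_mem_polShift (momFun_mem X) hH
      rwa [show 1 + (r + s) = r + (s + 1) by ring] at this
    · have := mul_mem_polShift hG.mem hK
      rwa [show s + (r + 1) = r + (s + 1) by ring] at this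
    · rw [pwBracket_mul_right, ← h, ← k]
      rfl
  | add s G G' _ _ hG hG' =>
    obtain ⟨H, hH, h⟩ := hG
    obtain ⟨K, hK, k⟩ := hG'
    refine ⟨H + K, add_mem hH hK, fun ζ => ?_⟩
    rw [pwBracket_add_right, ← h, ← k]
    rfl

variable [CovariantDerivative.ContMDiffCovariantDerivative nabla ∞]

/-- `HasPolBracket.of_generators` is used in both arguments: the brackets of `F` with the generators
come from the same induction after exchanging the arguments by symmetry. -/
theorem HasPolBracket.of_isMomentumPoly {r s : ℕ} {F G : SmoothFunCotangent E M}
    (hF : IsMomentumPoly r F) (hG : IsMomentumPoly s G) : HasPolBracket nabla (r + s) F G := by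
  have h00 : ∀ f g, HasPolBracket nabla 0 (pullFun f : SmoothFunCotangent E M) (pullFun g) :=
    fun f g => ⟨0, zero_mem _, fun ζ => (pwBracket_pullFun_pullFun nabla f g ζ).symm⟩
  have h10 : ∀ X f, HasPolBracket nabla 1 (momFun X : SmoothFunCotangent E M) (pullFun f) :=
    fun X f => ⟨pullFun (lieDeriv X f), pullFun_mem _,
      fun ζ => (pwBracket_momFun_pullFun nabla X f ζ).symm⟩
  have h11 : ∀ X Y, HasPolBracket nabla 2 (momFun X : SmoothFunCotangent E M) (momFun Y) :=
    fun X Y => ⟨momFun (symBracket nabla X Y), momFun_mem _,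
      fun ζ => (pwBracket_momFun_momFun nabla X Y ζ).symm⟩
  refine .of_generators (fun f => ?_) (fun X => ?_) hG
  · have := HasPolBracket.of_generators (h00 f) (fun X => (h10 X f).symm) hF
    rw [zero_add] at this
    exact this.symm
  · have := HasPolBracket.of_generators (h10 X) (h11 X) hF
    rw [add_comm] at this
    exact this.symm

/-- The Patterson–Walker bracket of polynomials in momenta of degrees `r` and `s` is one of degree
`r + s - 1`. -/
theorem HasPolBracket.of_mem {r s : ℕ} {F G : SmoothFunCotangent E M}
    (hF : F ∈ PolDeg E M r) (hG : G ∈ PolDeg E M s) : HasPolBracket nabla (r + s) F G := by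
  refine exists_mem_polShift_of_eventually fun x₀ => ?_
  obtain ⟨F', hF', hFF'⟩ := exists_isMomentumPoly_of_mem hF x₀
  obtain ⟨G', hG', hGG'⟩ := exists_isMomentumPoly_of_mem hG x₀
  obtain ⟨H, hH, h⟩ := HasPolBracket.of_isMomentumPoly (nabla := nabla) hF' hG'
  refine ⟨H, hH, ?_⟩
  -- The bracket involves first derivatives, so at each nearby `x` the functions must agree on a
  -- neighbourhood of `x`.
  filter_upwards [hFF'.eventually_nhds, hGG'.eventually_nhds] with x hFx hGx ζ
  rw [h]
  exact pwBracket_congr_over nabla hFx hGx ζ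

theorem exists_pol_eq_pwBracket (F G : Pol E M) :
    ∃ H : Pol E M, ∀ ζ, H.1 ζ = pwBracket nabla F.1 G.1 ζ := by
  obtain ⟨F, hF⟩ := F
  obtain ⟨G, hG⟩ := G
  -- Additivity in the second argument passes from homogeneous functions to sums; with the symmetry
  -- of the bracket it is applied to each argument in turn.
  have key : ∀ K : SmoothFunCotangent E M,
      (∀ s, ∀ L ∈ PolDeg E M s, ∃ H ∈ Pol E M, ∀ ζ, H ζ = pwBracket nabla K L ζ) →
      ∀ L ∈ Pol E M, ∃ H ∈ Pol E M, ∀ ζ, H ζ = pwBracket nabla K L ζ := by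
    intro K hK L hL
    refine Submodule.iSup_induction (PolDeg E M) (motive := fun L => ∃ H ∈ Pol E M, ∀ ζ,
      H ζ = pwBracket nabla K L ζ) hL hK ⟨0, zero_mem _, fun ζ => ?_⟩ ?_
    · exact (pwBracket_zero_right nabla K ζ).symm
    · rintro L L' ⟨H, hH, h⟩ ⟨H', hH', h'⟩
      refine ⟨H + H', add_mem hH hH', fun ζ => ?_⟩
      rw [pwBracket_add_right, ← h, ← h']
      rfl
  obtain ⟨H, hH, h⟩ := key F (fun s L hL => by
    obtain ⟨H, hH, h⟩ := key L (fun r K hK => by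
      obtain ⟨H, hH, h⟩ := HasPolBracket.of_mem (nabla := nabla) hL hK
      exact ⟨H, polShift_le_pol _ hH, h⟩) F hF
    exact ⟨H, hH, fun ζ => by rw [h, pwBracket_comm]⟩) G hG
  exact ⟨⟨H, hH⟩, h⟩

variable (nabla) in
/-- The Patterson–Walker bracket on the polynomials in momenta. -/
def polBracket : Pol E M →ₗ[ℝ] Pol E M →ₗ[ℝ] Pol E M :=
  have spec : ∀ F G : Pol E M, ∀ ζ, (exists_pol_eq_pwBracket (nabla := nabla) F G).choose.1 ζ =
    pwBracket nabla F.1 G.1 ζ := fun F G => (exists_pol_eq_pwBracket F G).choose_spec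
  LinearMap.mk₂ ℝ (fun F G => (exists_pol_eq_pwBracket (nabla := nabla) F G).choose)
    (fun F F' G => Subtype.ext <| ContMDiffMap.ext fun ζ => by
      refine (spec _ _ ζ).trans ?_
      rw [pwBracket_comm]
      refine (pwBracket_add_right nabla G.1 F.1 F'.1 ζ).trans ?_
      rw [pwBracket_comm, pwBracket_comm nabla G.1, ← spec, ← spec]
      rfl)
    (fun c F G => Subtype.ext <| ContMDiffMap.ext fun ζ => by
      refine (spec _ _ ζ).trans ?_
      rw [pwBracket_comm]
      refine (pwBracket_smul_right nabla G.1 c F.1 ζ).trans ?_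
      rw [pwBracket_comm, ← spec]
      rfl)
    (fun F G G' => Subtype.ext <| ContMDiffMap.ext fun ζ => by
      refine (spec _ _ ζ).trans ((pwBracket_add_right nabla F.1 G.1 G'.1 ζ).trans ?_)
      rw [← spec, ← spec]
      rfl)
    (fun c F G => Subtype.ext <| ContMDiffMap.ext fun ζ => by
      refine (spec _ _ ζ).trans ((pwBracket_smul_right nabla F.1 c G.1 ζ).trans ?_)
      rw [← spec]
      rfl)

theorem polBracket_apply (F G : Pol E M) (ζ : CotangentBundle E M) :
    (polBracket nabla F G).1 ζ = pwBracket nabla F.1 G.1 ζ :=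
  (exists_pol_eq_pwBracket (nabla := nabla) F G).choose_spec ζ

end bracket

end

/-! ### Existence and uniqueness of the symmetric Schouten bracket. -/

section

open Filter Topology

variable {E : Type*} [NormedAddCommGroup E] [NormedSpace ℝ E]
  {M : Type*} [TopologicalSpace M] [ChartedSpace E M] [IsManifold 𝓘(ℝ, E) ∞ M]
  [FiniteDimensional ℝ E] [T2Space M]
  {nabla : CovariantDerivative 𝓘(ℝ, E) E (TangentSpace 𝓘(ℝ, E) : M → Type _)}

theorem exists_liftAll_eq {r : ℕ} {F : SmoothFunCotangent E M} (hF : F ∈ PolDeg E M r) :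
    ∃ X : SymMultivectorField E M r, liftAll E M (incl r X) = F := by
  rw [← range_liftHom] at hF
  obtain ⟨X, rfl⟩ := hF
  exact ⟨X, liftAll_incl r X⟩

variable [CovariantDerivative.ContMDiffCovariantDerivative nabla ∞]

variable (nabla) in
/-- The symmetric Schouten bracket, transported from the polynomials in momenta. -/
def schoutenBracket : SymMultivectorFields E M →ₗ[ℝ] SymMultivectorFields E M →ₗ[ℝ]
    SymMultivectorFields E M :=
  ((polBracket nabla).compl₁₂ (liftEquiv E M).toLinearMap (liftEquiv E M).toLinearMap).compr₂
    (liftEquiv E M).symm.toLinearMap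

theorem liftEquiv_schoutenBracket (X Y : SymMultivectorFields E M) :
    liftEquiv E M (schoutenBracket nabla X Y) =
      polBracket nabla (liftEquiv E M X) (liftEquiv E M Y) := by
  simp [schoutenBracket]

theorem liftAll_schoutenBracket (X Y : SymMultivectorFields E M) (ζ : CotangentBundle E M) :
    liftAll E M (schoutenBracket nabla X Y) ζ =
      pwBracket nabla (liftAll E M X) (liftAll E M Y) ζ :=
  (congrArg (fun F : Pol E M => F.1 ζ) (liftEquiv_schoutenBracket X Y)).trans
    (polBracket_apply _ _ ζ)

/-- The lift is injective and multiplicative, so each axiom becomes a property of the bracket of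
functions on `T*M`. -/
theorem isSymSchoutenBracket_schoutenBracket :
    IsSymSchoutenBracket nabla (schoutenBracket (E := E) (M := M) nabla) where
  vec_fun X f := by
    refine liftAll_injective (ContMDiffMap.ext fun ζ => ?_)
    rw [liftAll_schoutenBracket, liftAll_ofVec, liftAll_ofFun, liftAll_ofFun,
      pwBracket_momFun_pullFun]
  vec_vec X Y := by
    refine liftAll_injective (ContMDiffMap.ext fun ζ => ?_)
    rw [liftAll_schoutenBracket, liftAll_ofVec, liftAll_ofVec, liftAll_ofVec,
      pwBracket_momFun_momFun]
  degree r s X Y k hk := by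
    have hX : liftAll E M (incl r X) ∈ PolDeg E M r := by
      rw [liftAll_incl, ← range_liftHom]; exact ⟨X, rfl⟩
    have hY : liftAll E M (incl s Y) ∈ PolDeg E M s := by
      rw [liftAll_incl, ← range_liftHom]; exact ⟨Y, rfl⟩
    obtain ⟨H, hH, h⟩ := HasPolBracket.of_mem (nabla := nabla) hX hY
    have h1 : liftAll E M (schoutenBracket nabla (incl r X) (incl s Y)) = H :=
      ContMDiffMap.ext fun ζ => by rw [liftAll_schoutenBracket, h]
    -- For `n = 0` the space of possible values is zero; for `n + 1` the bracket sits in degree `n`,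
    -- which `hk` separates from `k`.
    generalize r + s = n at hk hH
    cases n with
    | zero =>
      rw [(Submodule.mem_bot ℝ).1 hH, ← map_zero (liftAll E M)] at h1
      rw [liftAll_injective h1]
      rfl
    | succ n =>
      obtain ⟨Z, hZ⟩ := exists_liftAll_eq hH
      rw [liftAll_injective (h1.trans hZ.symm)]
      exact DirectSum.of_eq_of_ne _ _ _ (by omega)
  derivation X Y Z := by
    refine liftAll_injective (ContMDiffMap.ext fun ζ => ?_)
    rw [liftAll_schoutenBracket, liftAll_symProd, pwBracket_mul_right, map_add, liftAll_symProd,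
      liftAll_symProd]
    change _ = liftAll E M (schoutenBracket nabla X Y) ζ * _ +
      _ * liftAll E M (schoutenBracket nabla X Z) ζ
    rw [liftAll_schoutenBracket, liftAll_schoutenBracket]
    ring
  comm X Y := by
    refine liftAll_injective (ContMDiffMap.ext fun ζ => ?_)
    rw [liftAll_schoutenBracket, liftAll_schoutenBracket, pwBracket_comm]

namespace IsSymSchoutenBracket

variable {B : SymMultivectorFields E M →ₗ[ℝ] SymMultivectorFields E M →ₗ[ℝ]
  SymMultivectorFields E M}

theorem liftAll_derivation (hB : IsSymSchoutenBracket nabla B) (X Y Z : SymMultivectorFields E M)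
    (ζ : CotangentBundle E M) :
    liftAll E M (B X (symProd E M Y Z)) ζ =
      liftAll E M (B X Y) ζ * liftAll E M Z ζ + liftAll E M Y ζ * liftAll E M (B X Z) ζ := by
  rw [hB.derivation, map_add, liftAll_symProd, liftAll_symProd]
  rfl

/-- No component `k` satisfies `k + 1 = 0`, so the degree axiom annihilates all of them. -/
theorem fun_fun (hB : IsSymSchoutenBracket nabla B) (f g : SmoothFun E M) :
    B (incl 0 (ofFun f)) (incl 0 (ofFun g)) = 0 :=
  DFinsupp.ext fun k => hB.degree 0 0 _ _ k (by omega)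

/-- A symmetric Schouten bracket is a local operator. -/
theorem liftAll_congr (hB : IsSymSchoutenBracket nabla B) {X Y Y' : SymMultivectorFields E M}
    {x : M} (h : ∀ᶠ y in 𝓝 x, ∀ ζ : CotangentSpace E y,
      liftAll E M Y ⟨y, ζ⟩ = liftAll E M Y' ⟨y, ζ⟩) (ζ : CotangentSpace E x) :
    liftAll E M (B X Y) ⟨x, ζ⟩ = liftAll E M (B X Y') ⟨x, ζ⟩ := by
  obtain ⟨φ, hφ, -⟩ := (SmoothBumpFunction.nhds_basis_support (I := 𝓘(ℝ, E)) h).mem_iff.1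
    (Filter.univ_mem (f := 𝓝 x))
  let f : SmoothFun E M := ⟨φ, φ.contMDiff⟩
  -- The support of the bump function lies where the two lifts agree. The derivation rule is then
  -- applied to both products at `x`, where `f = 1` and the terms containing `B X f` coincide.
  have h1 : symProd E M (incl 0 (ofFun f)) Y = symProd E M (incl 0 (ofFun f)) Y' := by
    refine liftAll_injective (ContMDiffMap.ext fun η => ?_)
    rw [liftAll_symProd, liftAll_symProd, liftAll_ofFun]
    change φ η.proj * _ = φ η.proj * _
    by_cases hη : η.proj ∈ tsupport φ
    · exact congrArg _ (hφ hη η.snd)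
    · rw [image_eq_zero_of_notMem_tsupport hη, zero_mul, zero_mul]
  have h2 := congrArg (fun Z => liftAll E M (B X Z) ⟨x, ζ⟩) h1
  have h3 : pullFun f ⟨x, ζ⟩ = 1 := φ.eq_one
  simp only [hB.liftAll_derivation, h.self_of_nhds ζ, liftAll_ofFun, h3] at h2
  linarith

/-- The vertical lift of the bracket of `X` and `Y` is the Patterson–Walker bracket of their
vertical lifts if this holds for functions and vector fields in place of `Y`. -/
theorem liftAll_eq_of_generators (hB : IsSymSchoutenBracket nabla B) {X : SymMultivectorFields E M}
    (h0 : ∀ f ζ, liftAll E M (B X (incl 0 (ofFun f))) ζ =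
      pwBracket nabla (liftAll E M X) (pullFun f) ζ)
    (h1 : ∀ Z ζ, liftAll E M (B X (incl 1 (ofVec Z))) ζ =
      pwBracket nabla (liftAll E M X) (momFun Z) ζ)
    {s : ℕ} {G : SmoothFunCotangent E M} (hG : IsMomentumPoly s G) (ζ : CotangentBundle E M) :
    ∀ Y, liftAll E M Y = G →
      liftAll E M (B X Y) ζ = pwBracket nabla (liftAll E M X) (liftAll E M Y) ζ := by
  induction hG with
  | zero s =>
    intro Y hY
    have hY' : Y = 0 := liftAll_injective (hY.trans (map_zero _).symm)
    rw [hY, hY', map_zero, map_zero, pwBracket_zero_right]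
    rfl
  | pull f =>
    intro Y hY
    rw [hY, ← h0, liftAll_injective (hY.trans (liftAll_ofFun f).symm)]
  | mom_mul s Z G hG ih =>
    intro Y hY
    -- Surjectivity lifts the factor `G` back to a field, and injectivity then factors `Y` itself,
    -- so the derivation axiom applies.
    obtain ⟨W, hW⟩ := exists_liftAll_eq hG.mem
    have hY' : Y = symProd E M (incl 1 (ofVec Z)) (incl s W) := by
      refine liftAll_injective ?_
      rw [hY, liftAll_symProd, hW, liftAll_ofVec]
    have h2 := ih _ hW
    rw [hY, pwBracket_mul_right, hY', hB.liftAll_derivation, h1, h2, hW, liftAll_ofVec]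
    ring
  | add s G G' hG hG' ih ih' =>
    intro Y hY
    obtain ⟨W, hW⟩ := exists_liftAll_eq hG.mem
    obtain ⟨W', hW'⟩ := exists_liftAll_eq hG'.mem
    have hY' : Y = incl s W + incl s W' := by
      refine liftAll_injective ?_
      rw [hY, map_add, hW, hW']
    rw [hY, pwBracket_add_right, hY', map_add, map_add, ← hW, ← hW', ← ih _ hW, ← ih' _ hW']
    rfl

/-- The axioms give the values on pairs of generators; commutativity lets the induction run first
over `X` and then over `Y`. -/
theorem liftAll_eq_of_isMomentumPoly (hB : IsSymSchoutenBracket nabla B) {r s : ℕ}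
    {X Y : SymMultivectorFields E M} (hX : IsMomentumPoly r (liftAll E M X))
    (hY : IsMomentumPoly s (liftAll E M Y)) (ζ : CotangentBundle E M) :
    liftAll E M (B X Y) ζ = pwBracket nabla (liftAll E M X) (liftAll E M Y) ζ := by
  have h00 : ∀ f g ζ, liftAll E M (B (incl 0 (ofFun f)) (incl 0 (ofFun g))) ζ =
      pwBracket nabla (liftAll E M (incl 0 (ofFun f))) (pullFun g) ζ := by
    intro f g ζ
    rw [hB.fun_fun, liftAll_ofFun, pwBracket_pullFun_pullFun, map_zero]
    rfl
  have h10 : ∀ Z f ζ, liftAll E M (B (incl 1 (ofVec Z)) (incl 0 (ofFun f))) ζ =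
      pwBracket nabla (liftAll E M (incl 1 (ofVec Z))) (pullFun f) ζ := by
    intro Z f ζ
    rw [hB.vec_fun, liftAll_ofVec, liftAll_ofFun, pwBracket_momFun_pullFun]
  have h01 : ∀ f Z ζ, liftAll E M (B (incl 0 (ofFun f)) (incl 1 (ofVec Z))) ζ =
      pwBracket nabla (liftAll E M (incl 0 (ofFun f))) (momFun Z) ζ := by
    intro f Z ζ
    rw [hB.comm, h10, pwBracket_comm, liftAll_ofVec, liftAll_ofFun]
  have h11 : ∀ Z W ζ, liftAll E M (B (incl 1 (ofVec Z)) (incl 1 (ofVec W))) ζ =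
      pwBracket nabla (liftAll E M (incl 1 (ofVec Z))) (momFun W) ζ := by
    intro Z W ζ
    rw [hB.vec_vec, liftAll_ofVec, liftAll_ofVec, pwBracket_momFun_momFun]
  refine hB.liftAll_eq_of_generators (fun f ζ => ?_) (fun Z ζ => ?_) hY ζ Y rfl
  · rw [hB.comm, hB.liftAll_eq_of_generators (h00 f) (h01 f) hX ζ X rfl, pwBracket_comm,
      liftAll_ofFun]
  · rw [hB.comm, hB.liftAll_eq_of_generators (h10 Z) (h11 Z) hX ζ X rfl, pwBracket_comm,
      liftAll_ofVec]

/-- Both brackets are local over `M`, so near the base point of `ζ` each field may be replaced by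
one whose lift is a sum of products of generators. -/
theorem liftAll_eq_homogeneous (hB : IsSymSchoutenBracket nabla B) {r s : ℕ}
    (X : SymMultivectorField E M r) (Y : SymMultivectorField E M s) (ζ : CotangentBundle E M) :
    liftAll E M (B (incl r X) (incl s Y)) ζ =
      pwBracket nabla (liftAll E M (incl r X)) (liftAll E M (incl s Y)) ζ := by
  have mem : ∀ (r : ℕ) (X : SymMultivectorField E M r),
      ∃ X' : SymMultivectorField E M r, IsMomentumPoly r (liftAll E M (incl r X')) ∧
      ∀ᶠ x in 𝓝 ζ.proj, ∀ η : CotangentSpace E x,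
        liftAll E M (incl r X) ⟨x, η⟩ = liftAll E M (incl r X') ⟨x, η⟩ := by
    intro r X
    have hX : liftAll E M (incl r X) ∈ PolDeg E M r := by
      rw [liftAll_incl, ← range_liftHom]; exact ⟨X, rfl⟩
    obtain ⟨G, hG, h⟩ := exists_isMomentumPoly_of_mem hX ζ.proj
    obtain ⟨X', hX'⟩ := exists_liftAll_eq hG.mem
    exact ⟨X', hX'.symm ▸ hG, by simpa only [hX'] using h⟩
  obtain ⟨X', hX', hXX'⟩ := mem r X
  obtain ⟨Y', hY', hYY'⟩ := mem s Y
  have h1 := hB.liftAll_congr (X := incl r X) hYY' ζ.snd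
  have h2 := hB.liftAll_congr (X := incl s Y') hXX' ζ.snd
  rw [hB.comm, hB.comm (incl s Y')] at h2
  refine (h1.trans h2).trans ((hB.liftAll_eq_of_isMomentumPoly hX' hY' ζ).trans ?_)
  exact (pwBracket_congr_over nabla hXX' hYY' ζ.snd).symm

theorem eq_schoutenBracket (hB : IsSymSchoutenBracket nabla B) : B = schoutenBracket nabla := by
  refine DirectSum.linearMap_ext _ fun r => LinearMap.ext fun X =>
    DirectSum.linearMap_ext _ fun s => LinearMap.ext fun Y => ?_
  refine liftAll_injective (ContMDiffMap.ext fun ζ => ?_)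
  exact (hB.liftAll_eq_homogeneous X Y ζ).trans (liftAll_schoutenBracket _ _ ζ).symm

end IsSymSchoutenBracket

end

end SymPoisson
end

/-! ### The vertical lift as an isomorphism of algebras. -/

theorem mainTheorem4 {E : Type*} [NormedAddCommGroup E] [NormedSpace ℝ E] [FiniteDimensional ℝ E]
    {M : Type*} [TopologicalSpace M] [ChartedSpace E M] [IsManifold 𝓘(ℝ, E) ∞ M]
    [T2Space M] [SecondCountableTopology M]
    (nabla : CovariantDerivative 𝓘(ℝ, E) E (TangentSpace 𝓘(ℝ, E) : M → Type _))
    [CovariantDerivative.ContMDiffCovariantDerivative nabla ∞] (torsionFree : nabla.torsion = 0) :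
    (∃! B, IsSymSchoutenBracket nabla B) ∧
    ∀ B, IsSymSchoutenBracket nabla B →
      ∃ P : Pol E M →ₗ[ℝ] Pol E M →ₗ[ℝ] Pol E M,
        (∀ (F G : Pol E M) (ζ : CotangentBundle E M),
          (P F G).1 ζ = pwBracket nabla F.1 G.1 ζ) ∧
        (∀ F G : Pol E M, P F G = P G F) ∧
        ∃ Φ : SymMultivectorFields E M ≃ₗ[ℝ] Pol E M,
          (∀ (X : SymMultivectorFields E M) (ζ : CotangentBundle E M),
            (Φ X).1 ζ = verticalLift X ζ) ∧
          ∀ X Y : SymMultivectorFields E M, Φ (B X Y) = P (Φ X) (Φ Y) := by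

  refine ⟨⟨schoutenBracket nabla, isSymSchoutenBracket_schoutenBracket,
    fun B hB => hB.eq_schoutenBracket⟩, fun B hB => ?_⟩
  refine ⟨polBracket nabla, polBracket_apply, fun F G => ?_, liftEquiv E M, liftAll_apply,
    fun X Y => ?_⟩
  · refine Subtype.ext (ContMDiffMap.ext fun ζ => ?_)
    rw [polBracket_apply, polBracket_apply, pwBracket_comm]
  · rw [hB.eq_schoutenBracket, liftEquiv_schoutenBracket]
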